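/- Let ${\cal N}$ be a von Neumann algebra on a complex Hilbert space ${\cal H}$ with a normal semifinite faithful trace ${\cal T}$, and let $({\cal N},D,\mathscr{A})$ be a semifinite spectral triple: $D$ is a self-adjoint operator affiliated with ${\cal N}$ and $\mathscr{A}\subset{\cal N}$ is a $*$-algebra such that each $A\in\mathscr{A}$ preserves $\mathrm{Dom}(D)$, $[D,A]$ extends from $\mathrm{Dom}(D)$ to a bounded element of ${\cal N}$, and $A(1+D^2)^{-1/2}$ lies in the norm closure of $\{B\in{\cal N}:{\cal T}(|B|)<\infty\}$. Let ${\cal A}$ be the norm closure of $\mathscr{A}$ and let $M({\cal A},{\cal N})=\{m\in{\cal N}: m{\cal A}\subset{\cal A},\ {\cal A}m\subset{\cal A}\}$. An unbounded ${\cal A}$-multiplier is a closed densely defined (possibly unbounded) operator $T$ affiliated with ${\cal N}$ such that its bounded transform $F(T)=T(1+T^*T)^{-1/2}$ lies in $M({\cal A},{\cal N})$ and $(1+T^*T)^{-1/2}{\cal A}$ is a dense subset of ${\cal A}$. A self-adjoint operator $H$ affiliated with ${\cal N}$ is called $D$-differentiable if there is a core ${\cal E}$ of $D$ such that for every $\mu\in\mathbb{R}\setminus\{0\}$: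 (i) $(H-i\mu)^{-1}{\cal E}\subset\mathrm{Dom}(D)\cap\mathrm{Dom}(H)$ and $D(H-i\mu)^{-1}{\cal E}\subset\mathrm{Dom}(H)$; (ii) $[D,H](H-i\mu)^{-1}$ extends from ${\cal E}$ to a bounded operator in ${\cal N}$. Let $H$ be an unbounded ${\cal A}$-multiplier that is self-adjoint and $D$-differentiable. Then $F(H)$ is $D$-differentiable. Moreover $F(H)$ preserves $\mathrm{Dom}(D)$, the commutator $[D,F(H)]$ extends from $\mathrm{Dom}(D)$ to a bounded operator in ${\cal N}$, and $$\|[D,F(H)]\|\le\|[D,H](H+i)^{-1}\|,$$ where the norms are those of the bounded extensions, the one on the right being taken from any core ${\cal E}$ of $D$ for which (i) and (ii) hold. -/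

import Mathlib

open scoped ENNReal NNReal ComplexOrder InnerProductSpace

namespace Callias

section Operators

variable {E : Type*} [NormedAddCommGroup E] [InnerProductSpace ℂ E]

/-- The product `S T` of two unbounded operators, on its natural domain
`{x ∈ Dom T | T x ∈ Dom S}`. -/
def pcomp (S T : E →ₗ.[ℂ] E) : E →ₗ.[ℂ] E where
  domain := (S.domain.comap T.toFun).map T.domain.subtype
  toFun :=
    { toFun := fun x => S ⟨T ⟨x, by
          obtain ⟨y, -, hy⟩ := Submodule.mem_map.1 x.2
          rw [← hy]; exact y.2⟩, by
          obtain ⟨x, hx⟩ := x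
          obtain ⟨y, hy, rfl⟩ := Submodule.mem_map.1 hx
          exact hy⟩
      map_add' := fun x y => by
        rw [← S.map_add]
        congr 1
        apply Subtype.ext
        change _ = T _ + T _
        rw [← T.map_add]
        rfl
      map_smul' := fun c x => by
        rw [RingHom.id_apply, ← S.map_smul]
        congr 1
        apply Subtype.ext
        change _ = c • T _
        rw [← T.map_smul]
        rfl }

theorem mem_pcomp_domain {S T : E →ₗ.[ℂ] E} {x : E} :
    x ∈ (pcomp S T).domain ↔ ∃ hx : x ∈ T.domain, T ⟨x, hx⟩ ∈ S.domain := by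
  constructor
  · intro h
    obtain ⟨y, hy, rfl⟩ := Submodule.mem_map.1 h
    exact ⟨y.2, hy⟩
  · rintro ⟨hx, h⟩
    exact Submodule.mem_map.2 ⟨⟨x, hx⟩, h, rfl⟩

theorem pcomp_apply {S T : E →ₗ.[ℂ] E} {x : E} (hx : x ∈ T.domain) (h : T ⟨x, hx⟩ ∈ S.domain) :
    pcomp S T ⟨x, mem_pcomp_domain.2 ⟨hx, h⟩⟩ = S ⟨T ⟨x, hx⟩, h⟩ := rfl

/-- The commutator `[S, T] = S T - T S`, on its natural domain `Dom(S T) ∩ Dom(T S)`. -/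
def commutator (S T : E →ₗ.[ℂ] E) : E →ₗ.[ℂ] E := pcomp S T - pcomp T S

/-- `(T - z)⁻¹`, with domain the range of `T - z` (when `T - z` is injective). -/
noncomputable def resolvent (T : E →ₗ.[ℂ] E) (z : ℂ) : E →ₗ.[ℂ] E :=
  ((-z) • (LinearMap.id : E →ₗ[ℂ] E) +ᵥ T).inverse

/-- The everywhere defined operator given by a bounded operator. -/
def ofBounded (B : E →L[ℂ] E) : E →ₗ.[ℂ] E := (B : E →ₗ[ℂ] E).toPMap ⊤

/-- The operator `S` is defined on all of `V`, and the bounded operator `B` agrees with it there: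
`S` extends from `V` to the bounded operator `B`. -/
def ExtendsFrom (S : E →ₗ.[ℂ] E) (V : Submodule ℂ E) (B : E →L[ℂ] E) : Prop :=
  ∀ x ∈ V, ∃ hx : x ∈ S.domain, S ⟨x, hx⟩ = B x

variable [CompleteSpace E]

/-- The operator `1 + T* T` on its natural domain. -/
noncomputable def oneAddSq (T : E →ₗ.[ℂ] E) : E →ₗ.[ℂ] E :=
  (LinearMap.id : E →ₗ[ℂ] E) +ᵥ pcomp T.adjoint T

theorem oneAddSq_inner {T : E →ₗ.[ℂ] E} (hd : Dense (T.domain : Set E))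
    (y : (oneAddSq T).domain) :
    ∃ hy : (y : E) ∈ T.domain,
      ⟪oneAddSq T y, (y : E)⟫_ℂ = ⟪(y : E), (y : E)⟫_ℂ + ⟪T ⟨y, hy⟩, T ⟨y, hy⟩⟫_ℂ := by
  obtain ⟨y, hy⟩ := y
  obtain ⟨h1, h2⟩ := mem_pcomp_domain.1 (show y ∈ (pcomp T.adjoint T).domain from hy)
  refine ⟨h1, ?_⟩
  have e : oneAddSq T ⟨y, hy⟩ = y + T.adjoint ⟨T ⟨y, h1⟩, h2⟩ := rfl
  rw [e, inner_add_left]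
  congr 1
  exact LinearPMap.adjoint_isFormalAdjoint hd ⟨T ⟨y, h1⟩, h2⟩ ⟨y, h1⟩

theorem oneAddSq_ker {T : E →ₗ.[ℂ] E} (hd : Dense (T.domain : Set E)) :
    LinearMap.ker (oneAddSq T).toFun = ⊥ := by
  rw [LinearMap.ker_eq_bot']
  intro y hy
  obtain ⟨h1, h2⟩ := oneAddSq_inner hd y
  have hy' : oneAddSq T y = 0 := hy
  rw [hy', inner_zero_left] at h2
  have h3 := congrArg Complex.re h2
  have a := inner_self_nonneg (𝕜 := ℂ) (x := (T ⟨y, h1⟩))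
  have b := inner_self_nonneg (𝕜 := ℂ) (x := (y : E))
  simp only [Complex.zero_re, Complex.add_re] at h3
  simp only [RCLike.re_to_complex] at a b
  have c : (⟪(y : E), (y : E)⟫_ℂ).re = 0 := by linarith
  exact Subtype.ext ((re_inner_self_nonpos (𝕜 := ℂ)).1 (le_of_eq c))

/-- von Neumann: for `T` closed and densely defined, `1 + T* T` has an everywhere defined bounded
inverse. -/
theorem exists_inverse_oneAddSq {T : E →ₗ.[ℂ] E} (hc : T.IsClosed)
    (hd : Dense (T.domain : Set E)) :
    ∃ R : E →L[ℂ] E, ofBounded R = (oneAddSq T).inverse := by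
  classical
  have hcl : IsClosed ((T.graph.map (WithLp.linearEquiv 2 ℂ (E × E)).symm.toLinearMap :
      Submodule ℂ (WithLp 2 (E × E))) : Set (WithLp 2 (E × E))) := by
    rw [Submodule.map_coe, LinearEquiv.coe_coe, LinearEquiv.image_eq_preimage_symm]
    exact IsClosed.preimage (WithLp.prod_continuous_ofLp 2 E E) hc
  set G : Submodule ℂ (WithLp 2 (E × E)) :=
    T.graph.map (WithLp.linearEquiv 2 ℂ (E × E)).symm.toLinearMap with hG
  have : CompleteSpace G := hcl.completeSpace_coe
  have key : ∀ x : E, ∃ y : (oneAddSq T).domain,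
      oneAddSq T y = x ∧ (G.starProjection (WithLp.toLp 2 (x, (0 : E)))).fst = y := by
    intro x
    set p := G.starProjection (WithLp.toLp 2 (x, (0 : E))) with hp
    have hpG : p ∈ G := Submodule.starProjection_apply_mem _ _
    obtain ⟨q, hq, hqp⟩ := Submodule.mem_map.1 hpG
    obtain ⟨y, hy1, hy2⟩ := (LinearPMap.mem_graph_iff _).1 hq
    have e1 : p.fst = y := by rw [← hqp, hy1]; rfl
    have e2 : p.snd = T y := by rw [← hqp, hy2]; rfl
    have horth : ∀ a : T.domain, ⟪x - (y : E), (a : E)⟫_ℂ = ⟪T y, T a⟫_ℂ := by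
      intro a
      have ha : WithLp.toLp 2 ((a : E), T a) ∈ G :=
        Submodule.mem_map.2 ⟨((a : E), T a), T.mem_graph a, rfl⟩
      have h := Submodule.starProjection_inner_eq_zero (K := G) (WithLp.toLp 2 (x, (0 : E))) _ ha
      rw [← hp, WithLp.prod_inner_apply] at h
      have f1 : (WithLp.toLp 2 (x, (0 : E)) - p).ofLp.1 = x - y := by rw [← e1]; rfl
      have f2 : (WithLp.toLp 2 (x, (0 : E)) - p).ofLp.2 = 0 - T y := by rw [← e2]; rfl
      rw [f1, f2] at h
      simp only [zero_sub, inner_neg_left] at h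
      exact add_neg_eq_zero.1 h
    have hTy : T y ∈ T.adjoint.domain :=
      LinearPMap.mem_adjoint_domain_of_exists _ ⟨x - y, horth⟩
    refine ⟨⟨y, mem_pcomp_domain.2 ⟨y.2, hTy⟩⟩, ?_, e1⟩
    have : oneAddSq T ⟨y, mem_pcomp_domain.2 ⟨y.2, hTy⟩⟩ = (y : E) + T.adjoint ⟨T y, hTy⟩ := rfl
    rw [this, LinearPMap.adjoint_apply_eq hd ⟨T y, hTy⟩ horth]
    abel
  let R : E →L[ℂ] E := (WithLp.fstL 2 ℂ E E) ∘L G.starProjection ∘L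
    (WithLp.prodContinuousLinearEquiv 2 ℂ E E).symm.toContinuousLinearMap ∘L
    ContinuousLinearMap.inl ℂ E E
  have hR : ∀ x, R x = (G.starProjection (WithLp.toLp 2 (x, (0 : E)))).fst := fun x => rfl
  have hdom : (oneAddSq T).inverse.domain = ⊤ := by
    rw [LinearPMap.inverse_domain, Submodule.eq_top_iff']
    intro x
    obtain ⟨y, hy, -⟩ := key x
    exact ⟨y, hy⟩
  refine ⟨R, LinearPMap.ext (by rw [hdom]; rfl) ?_⟩
  intro x h1 h2
  obtain ⟨y, hy, hy'⟩ := key x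
  rw [LinearPMap.inverse_apply_eq (oneAddSq_ker hd) (x := y) hy, ← hy']
  rfl

open scoped Classical in
/-- The bounded operator `(1 + T* T)⁻¹`, for `T` closed and densely defined. -/
noncomputable def invOneAddSq (T : E →ₗ.[ℂ] E) : E →L[ℂ] E :=
  if h : ∃ R : E →L[ℂ] E, ofBounded R = (oneAddSq T).inverse then h.choose else 0

theorem invOneAddSq_spec {T : E →ₗ.[ℂ] E} (hc : T.IsClosed) (hd : Dense (T.domain : Set E)) :
    ofBounded (invOneAddSq T) = (oneAddSq T).inverse := by
  have h := exists_inverse_oneAddSq hc hd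
  rw [invOneAddSq, dif_pos h]
  exact h.choose_spec

theorem invOneAddSq_nonneg {T : E →ₗ.[ℂ] E} (hc : T.IsClosed) (hd : Dense (T.domain : Set E)) :
    0 ≤ invOneAddSq T := by
  rw [ContinuousLinearMap.nonneg_iff_isPositive, ContinuousLinearMap.isPositive_iff_complex]
  intro x
  have hs := invOneAddSq_spec hc hd
  have hx : x ∈ (oneAddSq T).inverse.domain := by rw [← hs]; trivial
  have hx' := hx
  rw [LinearPMap.inverse_domain] at hx'
  obtain ⟨y, hy⟩ := hx'
  have e : invOneAddSq T x = y := by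
    rw [← LinearPMap.inverse_apply_eq (oneAddSq_ker hd) (x := y) (y := ⟨x, hx⟩) hy]
    obtain ⟨-, h⟩ := LinearPMap.ext_iff.1 hs
    exact h (x := x) (hf := trivial) (hg := hx)
  obtain ⟨h1, h2⟩ := oneAddSq_inner hd y
  have hy' : oneAddSq T y = x := hy
  rw [hy'] at h2
  have h3 : ⟪invOneAddSq T x, x⟫_ℂ = ⟪(y : E), (y : E)⟫_ℂ + ⟪T ⟨y, h1⟩, T ⟨y, h1⟩⟫_ℂ := by
    rw [e, ← inner_conj_symm, h2, map_add, inner_conj_symm, inner_conj_symm]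
  rw [h3, inner_self_eq_norm_sq_to_K, inner_self_eq_norm_sq_to_K]
  constructor
  · norm_cast
  · norm_cast
    positivity

/-- `(1 + T* T)^(-1/2)`: the positive square root of `(1 + T* T)⁻¹`. -/
noncomputable def invSqrtOneAddSq (T : E →ₗ.[ℂ] E) : E →L[ℂ] E := CFC.sqrt (invOneAddSq T)

/-- The bounded transform `F(T) = T (1 + T* T)^(-1/2)`. -/
noncomputable def boundedTransform (T : E →ₗ.[ℂ] E) : E →ₗ.[ℂ] E :=
  pcomp T (ofBounded (invSqrtOneAddSq T))

/-- A closed densely defined operator is affiliated with the von Neumann algebra `N` if each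
unitary of the commutant of `N` preserves its domain and commutes with it. -/
structure IsAffiliated (N : VonNeumannAlgebra E) (T : E →ₗ.[ℂ] E) : Prop where
  isClosed : T.IsClosed
  dense_domain : Dense (T.domain : Set E)
  commute : ∀ U ∈ unitary (E →L[ℂ] E), U ∈ N.commutant → ∀ x : T.domain,
    ∃ hx : U x ∈ T.domain, T ⟨U x, hx⟩ = U (T x)

/-- `τ`, restricted to the positive cone of `N`, is a normal semifinite faithful trace. -/
structure IsTrace (N : VonNeumannAlgebra E) (τ : (E →L[ℂ] E) → ℝ≥0∞) : Prop where
  map_add : ∀ a ∈ N, ∀ b ∈ N, 0 ≤ a → 0 ≤ b → τ (a + b) = τ a + τ b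
  map_smul : ∀ c : ℝ≥0, ∀ a ∈ N, 0 ≤ a → τ (((c : ℝ) : ℂ) • a) = c * τ a
  map_star_mul : ∀ a ∈ N, τ (star a * a) = τ (a * star a)
  faithful : ∀ a ∈ N, 0 ≤ a → τ a = 0 → a = 0
  normal : ∀ (S : Set (E →L[ℂ] E)) (a : E →L[ℂ] E), (∀ s ∈ S, s ∈ N ∧ 0 ≤ s) → S.Nonempty →
    DirectedOn (· ≤ ·) S → IsLUB S a → τ a = ⨆ s ∈ S, τ s
  semifinite : ∀ a ∈ N, 0 ≤ a → a ≠ 0 → ∃ b ∈ N, 0 ≤ b ∧ b ≠ 0 ∧ b ≤ a ∧ τ b < ∞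

/-- The `τ`-compact operators: the norm closure of `{A ∈ N | τ(|A|) < ∞}`. -/
def compacts (N : VonNeumannAlgebra E) (τ : (E →L[ℂ] E) → ℝ≥0∞) : Set (E →L[ℂ] E) :=
  closure {a | a ∈ N ∧ τ (CFC.abs a) < ∞}

/-- `(N, D, 𝒜)` is an (odd) semifinite spectral triple, with respect to the trace `τ` on `N`. -/
structure IsSemifiniteSpectralTriple (N : VonNeumannAlgebra E) (τ : (E →L[ℂ] E) → ℝ≥0∞)
    (D : E →ₗ.[ℂ] E) (𝒜 : NonUnitalStarSubalgebra ℂ (E →L[ℂ] E)) : Prop where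
  isTrace : IsTrace N τ
  isSelfAdjoint : IsSelfAdjoint D
  isAffiliated : IsAffiliated N D
  le : ∀ a ∈ 𝒜, a ∈ N
  bounded_commutator : ∀ a ∈ 𝒜, ∃ B ∈ N, ExtendsFrom (commutator D (ofBounded a)) D.domain B
  compact : ∀ a ∈ 𝒜, a * invSqrtOneAddSq D ∈ compacts N τ

/-- The multiplier algebra `M(A, N)`: the idealizer of `A` in `N`. -/
def multiplierAlgebra (A : NonUnitalStarSubalgebra ℂ (E →L[ℂ] E)) (N : VonNeumannAlgebra E) :
    StarSubalgebra ℂ (E →L[ℂ] E) where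
  carrier := {m | m ∈ N ∧ ∀ a ∈ A, m * a ∈ A ∧ a * m ∈ A}
  mul_mem' := fun {m n} hm hn => ⟨mul_mem hm.1 hn.1, fun a ha =>
    ⟨by rw [mul_assoc]; exact (hm.2 _ (hn.2 a ha).1).1,
     by rw [← mul_assoc]; exact (hn.2 _ (hm.2 a ha).2).2⟩⟩
  add_mem' := fun {m n} hm hn => ⟨add_mem hm.1 hn.1, fun a ha =>
    ⟨by rw [add_mul]; exact add_mem (hm.2 a ha).1 (hn.2 a ha).1,
     by rw [mul_add]; exact add_mem (hm.2 a ha).2 (hn.2 a ha).2⟩⟩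
  algebraMap_mem' := fun c => ⟨N.toStarSubalgebra.algebraMap_mem c, fun a ha =>
    ⟨by rw [← Algebra.smul_def]; exact A.smul_mem c ha,
     by rw [← Algebra.commutes, ← Algebra.smul_def]; exact A.smul_mem c ha⟩⟩
  star_mem' := fun {m} hm => ⟨star_mem hm.1, fun a ha =>
    ⟨by simpa using star_mem (hm.2 _ (star_mem ha)).2,
     by simpa using star_mem (hm.2 _ (star_mem ha)).1⟩⟩

/-- A (possibly unbounded) `A`-multiplier: a closed operator `T` affiliated with `N` whose bounded
transform lies in `M(A, N)` and for which `(1 + T* T)^(-1/2) A` is a dense subset of `A`. -/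
structure IsUnboundedMultiplier (A : NonUnitalStarSubalgebra ℂ (E →L[ℂ] E))
    (N : VonNeumannAlgebra E) (T : E →ₗ.[ℂ] E) : Prop where
  isAffiliated : IsAffiliated N T
  boundedTransform_mem : ∃ m ∈ multiplierAlgebra A N, boundedTransform T = ofBounded m
  mul_mem : ∀ a ∈ A, invSqrtOneAddSq T * a ∈ A
  dense : ∀ a ∈ A, a ∈ closure {b | ∃ c ∈ A, b = invSqrtOneAddSq T * c}

/-- The conditions in the definition of `D`-differentiability of `H`, for a given core `V`
of `D`. -/
structure IsDifferentiableOnCore (N : VonNeumannAlgebra E) (D H : E →ₗ.[ℂ] E)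
    (V : Submodule ℂ E) : Prop where
  hasCore : D.HasCore V
  resolvent_mem : ∀ μ : ℝ, μ ≠ 0 → ∀ x ∈ V,
    ∃ hx : x ∈ (resolvent H (Complex.I * μ)).domain,
      resolvent H (Complex.I * μ) ⟨x, hx⟩ ∈ H.domain ∧
      ∃ hD : resolvent H (Complex.I * μ) ⟨x, hx⟩ ∈ D.domain,
        D ⟨resolvent H (Complex.I * μ) ⟨x, hx⟩, hD⟩ ∈ H.domain
  bounded : ∀ μ : ℝ, μ ≠ 0 → ∃ C ∈ N,
    ExtendsFrom (pcomp (commutator D H) (resolvent H (Complex.I * μ))) V C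

/-- `H` is a self-adjoint operator affiliated with `N` that is `D`-differentiable. -/
structure IsDifferentiable (N : VonNeumannAlgebra E) (D H : E →ₗ.[ℂ] E) : Prop where
  isSelfAdjoint : IsSelfAdjoint H
  isAffiliated : IsAffiliated N H
  exists_core : ∃ V : Submodule ℂ E, IsDifferentiableOnCore N D H V

end Operators

end Callias

/-! Write `R μ = (H - iμ)⁻¹`, `G = (1 + H²)⁻¹`, `S = G^(1/2)`, `m = F(H)`, and let `C` be the
bounded extension of `[D,H](H + i)⁻¹`. The starting point is `m = (2/π) ∫₀^∞ H (H² + 1 + s²)⁻¹ ds`,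
whose integrand is `(R μ + R (-μ)) / 2` with `μ² = 1 + s²`. Each resolvent has a bounded commutator
with `D` (`hasCommutator_res`), so finite Riemann sums do too. The issue is a bound on these
commutators that is uniform and equal to `‖C‖`: norm estimates of the single terms only decay like
`1/s`.

Two ideas give the bound. All commutators are expressed through one skew-adjoint operator: `[D, R μ]
= -A* (R 1 * C) B`, with `A`, `B` the operators `(H + i)(H ± iμ)⁻¹` (`hasCommutator_res_of_neg_one`,
`star_res_one_mul`). And `R 1 = S φ` with `φ` an isometry, so Reid's inequality
(`norm_map_le_of_symmetric`) bounds the form of `R 1 * C` by `‖C‖` times that of `S`. The resulting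
quadratic forms `⟪S (1 + s²G)⁻¹ x, x⟫` add up, over the nodes, to at most `‖x‖²`, because `(2/π) √t
∫ ds / (1 + s²t) = 1` and right-endpoint sums lie below this integral. Cauchy–Schwarz over the nodes
yields `‖C‖ ‖x‖ ‖y‖`.

The Riemann sums converge strongly to `m`, and the commutator bound survives
(`HasCommutator.exists_of_tendsto`). Differentiability of `m` then follows since an inverse of an
operator with bounded commutator has one as well (`HasCommutator.inv`). -/

namespace Callias

/-! ### Resolvents of a self-adjoint operator -/

section SelfAdjoint

/-- The map `H - iμ`. -/
noncomputable def subSmul {E : Type*} [NormedAddCommGroup E] [InnerProductSpace ℂ E]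
    (H : E →ₗ.[ℂ] E) (μ : ℝ) : H.domain →ₗ[ℂ] E :=
  H.toFun - (Complex.I * μ) • H.domain.subtype

theorem subSmul_apply {E : Type*} [NormedAddCommGroup E] [InnerProductSpace ℂ E]
    (H : E →ₗ.[ℂ] E) (μ : ℝ) (x : H.domain) :
    subSmul H μ x = H x - (Complex.I * μ) • (x : E) := rfl

variable {E : Type*} [NormedAddCommGroup E] [InnerProductSpace ℂ E] [CompleteSpace E]

theorem inner_map_comm {D : E →ₗ.[ℂ] E} (hD : IsSelfAdjoint D) (x y : D.domain) :
    ⟪D x, (y : E)⟫_ℂ = ⟪(x : E), D y⟫_ℂ := by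
  have h := LinearPMap.adjoint_isFormalAdjoint hD.dense_domain
  rw [LinearPMap.isSelfAdjoint_def.1 hD] at h
  exact h x y

theorem mem_domain_of_inner {D : E →ₗ.[ℂ] E} (hD : IsSelfAdjoint D) {y w : E}
    (h : ∀ x : D.domain, ⟪w, (x : E)⟫_ℂ = ⟪y, D x⟫_ℂ) :
    ∃ hy : y ∈ D.domain, D ⟨y, hy⟩ = w := by
  have h1 : y ∈ D.adjoint.domain := LinearPMap.mem_adjoint_domain_of_exists _ ⟨w, h⟩
  have h2 := LinearPMap.adjoint_apply_eq hD.dense_domain ⟨y, h1⟩ h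
  obtain ⟨h3, h4⟩ := LinearPMap.ext_iff.1 (LinearPMap.isSelfAdjoint_def.1 hD)
  refine ⟨h3 ▸ h1, ?_⟩
  rw [← h2]
  exact (h4 (hf := h1) (hg := h3 ▸ h1)).symm

/-- The cross term vanishes because `⟪H x, x⟫` is real. -/
theorem norm_sub_smul_sq {H : E →ₗ.[ℂ] E} (hH : IsSelfAdjoint H) (μ : ℝ) (x : H.domain) :
    ‖H x - (Complex.I * μ) • (x : E)‖ ^ 2 = ‖H x‖ ^ 2 + μ ^ 2 * ‖(x : E)‖ ^ 2 := by
  have h1 : (⟪H x, (x : E)⟫_ℂ).im = 0 := by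
    have h := inner_map_comm hH x x
    rw [← inner_conj_symm] at h
    exact Complex.conj_eq_iff_im.1 h |> fun h => by
      rw [← inner_conj_symm, Complex.conj_im, h, neg_zero]
  rw [@norm_sub_sq ℂ, norm_smul, inner_smul_right]
  simp only [RCLike.re_to_complex, Complex.mul_re, Complex.I_re, Complex.I_im, Complex.ofReal_re,
    Complex.ofReal_im, Complex.mul_im, h1, norm_mul, Complex.norm_I, Complex.norm_real]
  rw [mul_pow, mul_pow, Real.norm_eq_abs, sq_abs]
  ring

theorem norm_le_of_sub_smul {H : E →ₗ.[ℂ] E} (hH : IsSelfAdjoint H) {μ : ℝ} (hμ : μ ≠ 0)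
    (x : H.domain) : ‖(x : E)‖ ≤ |μ|⁻¹ * ‖H x - (Complex.I * μ) • (x : E)‖ := by
  have h := norm_sub_smul_sq hH μ x
  have h2 : |μ| * ‖(x : E)‖ ≤ ‖H x - (Complex.I * μ) • (x : E)‖ := by
    refine le_of_sq_le_sq ?_ (norm_nonneg _)
    rw [h, mul_pow, sq_abs]
    nlinarith [sq_nonneg ‖H x‖]
  rw [inv_mul_eq_div, le_div_iff₀ (abs_pos.2 hμ)]
  linarith

/-- The lower bound on `H - iμ` makes preimages of a convergent sequence Cauchy, and the graph of
`H` is closed. -/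
theorem isClosed_range_subSmul {H : E →ₗ.[ℂ] E} (hH : IsSelfAdjoint H) {μ : ℝ} (hμ : μ ≠ 0) :
    IsClosed (LinearMap.range (subSmul H μ) : Set E) := by
  refine isClosed_of_closure_subset fun y hy => ?_
  obtain ⟨u, hu, hlim⟩ := mem_closure_iff_seq_limit.1 hy
  choose v hv using hu
  have hc : CauchySeq fun n => (v n : E) := by
    rw [Metric.cauchySeq_iff']
    intro ε hε
    obtain ⟨n, hn⟩ := Metric.cauchySeq_iff'.1 hlim.cauchySeq (|μ| * ε)
      (mul_pos (abs_pos.2 hμ) hε)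
    refine ⟨n, fun k hk => ?_⟩
    have h1 := norm_le_of_sub_smul hH hμ (v k - v n)
    rw [← subSmul_apply, map_sub, hv, hv] at h1
    have h2 := hn k hk
    rw [dist_eq_norm] at h2 ⊢
    calc ‖(v k : E) - v n‖ ≤ |μ|⁻¹ * ‖u k - u n‖ := h1
      _ < |μ|⁻¹ * (|μ| * ε) := by
        exact mul_lt_mul_of_pos_left h2 (inv_pos.2 (abs_pos.2 hμ))
      _ = ε := by rw [inv_mul_cancel_left₀ (abs_pos.2 hμ).ne']
  obtain ⟨x, hx⟩ := cauchySeq_tendsto_of_complete hc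
  have h3 : Filter.Tendsto (fun n => H (v n)) Filter.atTop
      (nhds (y + (Complex.I * μ) • x)) := by
    refine (hlim.add (hx.const_smul (Complex.I * (μ : ℂ)))).congr fun n => ?_
    rw [← hv, subSmul_apply]; abel
  have h4 : (x, y + (Complex.I * μ) • x) ∈ H.graph :=
    hH.isClosed.mem_of_tendsto (hx.prodMk_nhds h3) (Filter.Eventually.of_forall fun n =>
      H.mem_graph (v n))
  obtain ⟨z, hz1, hz2⟩ := (LinearPMap.mem_graph_iff _).1 h4
  refine ⟨z, ?_⟩
  rw [subSmul_apply, hz2]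
  simp only at hz1
  rw [hz1]
  simp

/-- A vector `y` orthogonal to the closed range lies in the domain of `H* = H` with `H y = -iμ y`,
so the lower bound for `-μ` forces `y = 0`. -/
theorem subSmul_surjective {H : E →ₗ.[ℂ] E} (hH : IsSelfAdjoint H) {μ : ℝ} (hμ : μ ≠ 0) :
    Function.Surjective (subSmul H μ) := by
  rw [← LinearMap.range_eq_top]
  have hcl := isClosed_range_subSmul hH hμ
  have : CompleteSpace (LinearMap.range (subSmul H μ)) := hcl.completeSpace_coe
  rw [← Submodule.orthogonal_eq_bot_iff, Submodule.eq_bot_iff]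
  intro y hy
  have h1 : ∀ x : H.domain, ⟪(-(Complex.I * μ)) • y, (x : E)⟫_ℂ = ⟪y, H x⟫_ℂ := by
    intro x
    have h := (Submodule.mem_orthogonal' _ _).1 hy _ ⟨x, rfl⟩
    rw [subSmul_apply, inner_sub_right, inner_smul_right, sub_eq_zero] at h
    rw [h, inner_smul_left]
    simp
  obtain ⟨h2, h3⟩ := mem_domain_of_inner hH h1
  have h4 := norm_le_of_sub_smul hH (neg_ne_zero.2 hμ) ⟨y, h2⟩
  rw [h3] at h4
  simpa using h4

theorem exists_resolvent {H : E →ₗ.[ℂ] E} (hH : IsSelfAdjoint H) {μ : ℝ} (hμ : μ ≠ 0) :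
    ∃ R : E →L[ℂ] E, (∀ x, ∃ h : R x ∈ H.domain, H ⟨R x, h⟩ = x + (Complex.I * μ) • R x) ∧
      ∀ x, ‖R x‖ ≤ |μ|⁻¹ * ‖x‖ := by
  have hinj : LinearMap.ker (subSmul H μ) = ⊥ := by
    rw [LinearMap.ker_eq_bot']
    intro x hx
    have h := norm_le_of_sub_smul hH hμ x
    rw [← subSmul_apply, hx] at h
    simpa using h
  let e := LinearEquiv.ofBijective (subSmul H μ)
    ⟨LinearMap.ker_eq_bot.1 hinj, subSmul_surjective hH hμ⟩
  have he : ∀ x, H (e.symm x) - (Complex.I * μ) • (e.symm x : E) = x := fun x =>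
    e.apply_symm_apply x
  refine ⟨LinearMap.mkContinuous (H.domain.subtype ∘ₗ e.symm.toLinearMap) |μ|⁻¹ fun x => ?_,
    fun x => ⟨(e.symm x).2, ?_⟩, fun x => ?_⟩
  · have h := norm_le_of_sub_smul hH hμ (e.symm x)
    rwa [he] at h
  · exact sub_eq_iff_eq_add.1 (he x)
  · have h := norm_le_of_sub_smul hH hμ (e.symm x)
    rwa [he] at h

open scoped Classical in
/-- The bounded operator `(H - iμ)⁻¹`, for `H` self-adjoint and `μ ≠ 0`. -/
noncomputable def res (H : E →ₗ.[ℂ] E) (μ : ℝ) : E →L[ℂ] E :=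
  if h : IsSelfAdjoint H ∧ μ ≠ 0 then (exists_resolvent h.1 h.2).choose else 0

theorem res_spec {H : E →ₗ.[ℂ] E} (hH : IsSelfAdjoint H) {μ : ℝ} (hμ : μ ≠ 0) (x : E) :
    ∃ h : res H μ x ∈ H.domain, H ⟨res H μ x, h⟩ = x + (Complex.I * μ) • res H μ x := by
  have h : IsSelfAdjoint H ∧ μ ≠ 0 := ⟨hH, hμ⟩
  rw [res, dif_pos h]
  exact (exists_resolvent h.1 h.2).choose_spec.1 x

theorem norm_res_le {H : E →ₗ.[ℂ] E} (hH : IsSelfAdjoint H) {μ : ℝ} (hμ : μ ≠ 0) (x : E) :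
    ‖res H μ x‖ ≤ |μ|⁻¹ * ‖x‖ := by
  have h : IsSelfAdjoint H ∧ μ ≠ 0 := ⟨hH, hμ⟩
  rw [res, dif_pos h]
  exact (exists_resolvent h.1 h.2).choose_spec.2 x

theorem eq_of_sub_smul_eq {H : E →ₗ.[ℂ] E} (hH : IsSelfAdjoint H) {μ : ℝ} (hμ : μ ≠ 0)
    {x y : H.domain} (h : H x - (Complex.I * μ) • (x : E) = H y - (Complex.I * μ) • (y : E)) :
    (x : E) = y := by
  have h1 := norm_le_of_sub_smul hH hμ (x - y)
  rw [← subSmul_apply, map_sub, subSmul_apply, subSmul_apply, h] at h1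
  simpa [sub_eq_zero] using h1

theorem res_apply_sub {H : E →ₗ.[ℂ] E} (hH : IsSelfAdjoint H) {μ : ℝ} (hμ : μ ≠ 0)
    (y : H.domain) : res H μ (H y - (Complex.I * μ) • (y : E)) = y := by
  obtain ⟨h1, h2⟩ := res_spec hH hμ (H y - (Complex.I * μ) • (y : E))
  refine eq_of_sub_smul_eq hH hμ (x := ⟨_, h1⟩) ?_
  rw [h2]; simp

theorem res_eq_of_map {H : E →ₗ.[ℂ] E} (hH : IsSelfAdjoint H) {μ : ℝ} (hμ : μ ≠ 0) {x y : E}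
    (hy : y ∈ H.domain) (h : H ⟨y, hy⟩ = x + (Complex.I * μ) • y) : res H μ x = y := by
  have := res_apply_sub hH hμ ⟨y, hy⟩
  rw [h] at this
  simpa using this

theorem res_star {H : E →ₗ.[ℂ] E} (hH : IsSelfAdjoint H) {μ : ℝ} (hμ : μ ≠ 0) :
    star (res H μ) = res H (-μ) := by
  rw [ContinuousLinearMap.star_eq_adjoint, eq_comm, ContinuousLinearMap.eq_adjoint_iff]
  intro x y
  obtain ⟨h1, h2⟩ := res_spec hH hμ y
  obtain ⟨h3, h4⟩ := res_spec hH (neg_ne_zero.2 hμ) x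
  have h := inner_map_comm hH ⟨_, h3⟩ ⟨_, h1⟩
  rw [h2, h4, inner_add_left, inner_add_right, inner_smul_left, inner_smul_right] at h
  simp only [Complex.ofReal_neg, map_mul, Complex.conj_I, map_neg, Complex.conj_ofReal] at h
  linear_combination -h

theorem resolvent_eq {H : E →ₗ.[ℂ] E} (hH : IsSelfAdjoint H) {μ : ℝ} (hμ : μ ≠ 0) (x : E) :
    ∃ hx : x ∈ (resolvent H (Complex.I * μ)).domain,
      resolvent H (Complex.I * μ) ⟨x, hx⟩ = res H μ x := by
  set T : E →ₗ.[ℂ] E := (-(Complex.I * μ)) • (LinearMap.id : E →ₗ[ℂ] E) +ᵥ H with hT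
  have hTa : ∀ y : H.domain, T y = H y - (Complex.I * μ) • (y : E) := by
    intro y
    change (-(Complex.I * μ)) • (y : E) + H y = _
    rw [neg_smul]; abel
  have hker : LinearMap.ker T.toFun = ⊥ := by
    rw [LinearMap.ker_eq_bot']
    intro y hy
    have h : T y = 0 := hy
    have h1 := res_apply_sub hH hμ y
    rw [← hTa, h, map_zero] at h1
    exact Subtype.ext h1.symm
  obtain ⟨h1, h2⟩ := res_spec hH hμ x
  have h3 : T ⟨res H μ x, h1⟩ = x := by
    rw [hTa ⟨res H μ x, h1⟩, h2]; simp
  have hx : x ∈ T.inverse.domain := by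
    rw [LinearPMap.inverse_domain]; exact ⟨_, h3⟩
  exact ⟨hx, LinearPMap.inverse_apply_eq hker (y := ⟨x, hx⟩) h3⟩

end SelfAdjoint

/-- A closed unital star subalgebra is itself a C⋆-algebra, so the decomposition can be made inside
it. Affiliation only speaks of unitaries of the commutant; this extends it to the whole commutant.
-/
theorem exists_sum_four_unitary_of_isClosed {A : Type*} [CStarAlgebra A] (S : StarSubalgebra ℂ A)
    (hS : IsClosed (S : Set A)) {a : A} (ha : a ∈ S) :
    ∃ (u : Fin 4 → A) (c : Fin 4 → ℂ), a = ∑ i, c i • u i ∧ ∀ i, u i ∈ unitary A ∧ u i ∈ S := by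
  have : IsClosed (S : Set A) := hS
  obtain ⟨u, c, hu, -⟩ := CStarAlgebra.exists_sum_four_unitary (⟨a, ha⟩ : S)
  refine ⟨fun i => ((u i : S) : A), c, ?_, fun i => ⟨Unitary.mem_iff.2 ⟨?_, ?_⟩, (u i : S).2⟩⟩
  · have h := congrArg S.subtype hu
    rw [map_sum] at h
    exact h
  · exact congrArg Subtype.val (Unitary.star_mul_self_of_mem (u i).2)
  · exact congrArg Subtype.val (Unitary.mul_star_self_of_mem (u i).2)

/-! ### Calculus of bounded commutators with `D` -/

section BoundedCommutator

variable {E : Type*} [NormedAddCommGroup E] [InnerProductSpace ℂ E]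

/-- The bounded operator `a` preserves `Dom D` and `[D, a]` agrees with the bounded operator `K`
on `Dom D`. -/
def HasCommutator (D : E →ₗ.[ℂ] E) (a K : E →L[ℂ] E) : Prop :=
  ∀ x : D.domain, ∃ h : a x ∈ D.domain, D ⟨a x, h⟩ = a (D x) + K x

namespace HasCommutator

variable {D : E →ₗ.[ℂ] E} {a b K L : E →L[ℂ] E}

theorem one : HasCommutator D 1 0 := fun x => ⟨x.2, by simp⟩

theorem zero : HasCommutator D 0 0 := fun x => ⟨by simp, by
  simp only [zero_apply, add_zero]
  exact D.map_zero⟩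

theorem add (ha : HasCommutator D a K) (hb : HasCommutator D b L) :
    HasCommutator D (a + b) (K + L) := fun x => by
  obtain ⟨h1, h2⟩ := ha x
  obtain ⟨h3, h4⟩ := hb x
  refine ⟨D.domain.add_mem h1 h3, ?_⟩
  have h := D.map_add ⟨_, h1⟩ ⟨_, h3⟩
  rw [h2, h4] at h
  simp only [add_apply]
  exact h.trans (by abel)

theorem smul (ha : HasCommutator D a K) (c : ℂ) : HasCommutator D (c • a) (c • K) := fun x => by
  obtain ⟨h1, h2⟩ := ha x
  refine ⟨D.domain.smul_mem c h1, ?_⟩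
  have h := D.map_smul c ⟨_, h1⟩
  rw [h2] at h
  simp only [smul_apply]
  exact h.trans (smul_add _ _ _)

theorem sub (ha : HasCommutator D a K) (hb : HasCommutator D b L) :
    HasCommutator D (a - b) (K - L) := by
  have h := ha.add (hb.smul (-1))
  simpa [sub_eq_add_neg] using h

theorem mul (ha : HasCommutator D a K) (hb : HasCommutator D b L) :
    HasCommutator D (a * b) (a * L + K * b) := fun x => by
  obtain ⟨h3, h4⟩ := hb x
  obtain ⟨h1, h2⟩ := ha ⟨_, h3⟩
  refine ⟨h1, ?_⟩
  simp only [mul_apply_eq_comp, add_apply]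
  exact h2.trans (by rw [h4, map_add]; abel)

theorem sum {ι : Type*} {s : Finset ι} {a K : ι → E →L[ℂ] E}
    (h : ∀ i ∈ s, HasCommutator D (a i) (K i)) :
    HasCommutator D (∑ i ∈ s, a i) (∑ i ∈ s, K i) := by
  classical
  induction s using Finset.induction_on with
  | empty => simpa using zero
  | insert i s hi ih =>
    rw [Finset.sum_insert hi, Finset.sum_insert hi]
    exact (h i (by simp)).add (ih fun j hj => h j (by simp [hj]))

theorem unique (hd : Dense (D.domain : Set E)) (ha : HasCommutator D a K)
    (hb : HasCommutator D a L) : K = L := by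
  refine ContinuousLinearMap.ext fun x => ?_
  have h : Set.EqOn K L D.domain := fun x hx => by
    obtain ⟨h1, h2⟩ := ha ⟨x, hx⟩
    obtain ⟨h3, h4⟩ := hb ⟨x, hx⟩
    exact add_left_cancel (h2.symm.trans h4)
  exact congrFun (Continuous.ext_on hd K.continuous L.continuous h) x

theorem extendsFrom (ha : HasCommutator D a K) :
    ExtendsFrom (commutator D (ofBounded a)) D.domain K := fun x hx => by
  obtain ⟨h1, h2⟩ := ha ⟨x, hx⟩
  refine ⟨⟨mem_pcomp_domain.2 ⟨trivial, h1⟩, mem_pcomp_domain.2 ⟨hx, trivial⟩⟩, ?_⟩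
  have h3 : commutator D (ofBounded a) ⟨x, ⟨mem_pcomp_domain.2 ⟨trivial, h1⟩,
      mem_pcomp_domain.2 ⟨hx, trivial⟩⟩⟩ = D ⟨a x, h1⟩ - a (D ⟨x, hx⟩) := rfl
  rw [h3, h2]; simp

/-- The continuous map `(p, q) ↦ (a p, a q + K p)` sends the graph of `D` restricted to `V` into the
graph of `D`; taking closures extends this to the whole graph of `D`. -/
theorem of_core {V : Submodule ℂ E} (hc : D.IsClosed) (hV : D.HasCore V)
    (h : ∀ x (hx : x ∈ V), ∃ h : a x ∈ D.domain, D ⟨a x, h⟩ = a (D ⟨x, hV.le_domain hx⟩) + K x) :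
    HasCommutator D a K := by
  intro x
  have hcl : (D.domRestrict V).graph.topologicalClosure = D.graph := by
    rw [LinearPMap.IsClosable.graph_closure_eq_closure_graph, hV.closure_eq]
    exact hc.isClosable.leIsClosable LinearPMap.domRestrict_le
  have hx : ((x : E), D x) ∈ (D.domRestrict V).graph.topologicalClosure := hcl ▸ D.mem_graph x
  let Φ : E × E → E × E := fun p => (a p.1, a p.2 + K p.1)
  have hΦ : Continuous Φ := by fun_prop
  have hm : Set.MapsTo Φ ((D.domRestrict V).graph : Set (E × E)) (D.graph : Set (E × E)) := by
    rintro ⟨p, q⟩ hpq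
    obtain ⟨z, hz1, hz2⟩ := (LinearPMap.mem_graph_iff _).1 hpq
    simp only at hz1 hz2
    subst hz1 hz2
    obtain ⟨h1, h2⟩ := h z z.2.1
    have h3 : D.domRestrict V z = D ⟨z, hV.le_domain z.2.1⟩ := rfl
    have h4 := D.mem_graph ⟨_, h1⟩
    rw [h2] at h4
    change (a z, a (D.domRestrict V z) + K z) ∈ D.graph
    rw [h3]
    exact h4
  have h5 : Φ ((x : E), D x) ∈ closure (D.graph : Set (E × E)) :=
    hm.closure hΦ hx
  rw [IsClosed.closure_eq hc] at h5
  obtain ⟨z, hz1, hz2⟩ := (LinearPMap.mem_graph_iff _).1 h5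
  simp only [Φ] at hz1 hz2
  refine ⟨hz1 ▸ z.2, ?_⟩
  rw [← hz2]
  congr 1
  exact Subtype.ext hz1.symm

variable [CompleteSpace E]

theorem star (hD : IsSelfAdjoint D) (ha : HasCommutator D a K) :
    HasCommutator D (star a) (-star K) := fun x => by
  refine mem_domain_of_inner hD fun y => ?_
  obtain ⟨h1, h2⟩ := ha y
  have h := inner_map_comm hD x ⟨_, h1⟩
  rw [h2, inner_add_right] at h
  simp only [ContinuousLinearMap.star_eq_adjoint, neg_apply, inner_add_left,
    inner_neg_left, ContinuousLinearMap.adjoint_inner_left] at h ⊢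
  rw [h]; ring

/-- A weak limit of operators whose commutators with `D` are bounded uniformly by `c` has a
commutator bounded by `c`. -/
theorem exists_of_tendsto (hD : IsSelfAdjoint D) {c : ℝ} (hc : 0 ≤ c) {F G : ℕ → E →L[ℂ] E}
    (hF : ∀ n, HasCommutator D (F n) (G n)) (hG : ∀ n, ∀ x y, ‖⟪G n x, y⟫_ℂ‖ ≤ c * ‖x‖ * ‖y‖)
    (hlim : ∀ x, Filter.Tendsto (fun n => F n x) Filter.atTop (nhds (a x))) :
    ∃ K, HasCommutator D a K ∧ ‖K‖ ≤ c := by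
  -- Only the sesquilinear form of the commutator is used here: it makes sense before `a x` is known
  -- to lie in `Dom D`, and it passes to the limit.
  have hbd : ∀ x y : D.domain,
      ‖⟪a (D x), (y : E)⟫_ℂ - ⟪a x, D y⟫_ℂ‖ ≤ c * ‖(x : E)‖ * ‖(y : E)‖ := by
    intro x y
    have h1 : Filter.Tendsto (fun n => ‖⟪F n (D x), (y : E)⟫_ℂ - ⟪F n x, D y⟫_ℂ‖) Filter.atTop
        (nhds ‖⟪a (D x), (y : E)⟫_ℂ - ⟪a x, D y⟫_ℂ‖) :=
      (((hlim _).inner tendsto_const_nhds).sub ((hlim _).inner tendsto_const_nhds)).norm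
    refine le_of_tendsto h1 (Filter.Eventually.of_forall fun n => ?_)
    obtain ⟨h2, h3⟩ := hF n x
    have h := inner_map_comm hD ⟨_, h2⟩ y
    rw [h3, inner_add_left] at h
    simp only at h
    rw [← h, sub_add_cancel_left, norm_neg]
    exact hG n x y
  -- The bound makes `y ↦ ⟪a x, D y⟫` continuous, which puts `a x` into the domain of `D* = D`.
  have hdom : ∀ x : D.domain, ∃ h : a x ∈ D.domain, ‖D ⟨a x, h⟩ - a (D x)‖ ≤ c * ‖(x : E)‖ := by
    intro x
    let f : D.domain →ₗ[ℂ] ℂ := (innerₛₗ ℂ (a x)) ∘ₗ D.toFun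
    have hf : Continuous f := by
      refine AddMonoidHomClass.continuous_of_bound f (c * ‖(x : E)‖ + ‖a (D x)‖) fun y => ?_
      have h1 := hbd x y
      have h2 := norm_inner_le_norm (𝕜 := ℂ) (a (D x)) (y : E)
      have h3 := norm_sub_norm_le (⟪a x, D y⟫_ℂ) (⟪a (D x), (y : E)⟫_ℂ)
      rw [norm_sub_rev] at h3
      change ‖⟪a x, D y⟫_ℂ‖ ≤ (c * ‖(x : E)‖ + ‖a (D x)‖) * ‖(y : E)‖
      linarith
    have h1 : a x ∈ D.adjoint.domain := (LinearPMap.mem_adjoint_domain_iff D _).2 hf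
    rw [LinearPMap.isSelfAdjoint_def.1 hD] at h1
    refine ⟨h1, ?_⟩
    set v := D ⟨a x, h1⟩ - a (D x) with hv
    have h2 : ∀ y ∈ (D.domain : Set E), ‖⟪v, y⟫_ℂ‖ ≤ c * ‖(x : E)‖ * ‖y‖ := by
      intro y hy
      have h3 := hbd x ⟨y, hy⟩
      rw [← inner_map_comm hD ⟨a x, h1⟩ ⟨y, hy⟩, ← inner_sub_left, ← norm_neg,
        ← inner_neg_left, neg_sub] at h3
      exact h3
    have h4 : ‖⟪v, v⟫_ℂ‖ ≤ c * ‖(x : E)‖ * ‖v‖ := by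
      have hcl : IsClosed {y : E | ‖⟪v, y⟫_ℂ‖ ≤ c * ‖(x : E)‖ * ‖y‖} :=
        isClosed_le (by fun_prop) (by fun_prop)
      exact (hcl.closure_subset_iff.2 h2) (hD.dense_domain v)
    rw [inner_self_eq_norm_sq_to_K] at h4
    simp only [norm_pow, RCLike.norm_ofReal, abs_norm] at h4
    rcases eq_or_lt_of_le (norm_nonneg v) with h5 | h5
    · rw [← h5]; positivity
    · nlinarith
  choose h1 h2 using hdom
  let k : D.domain →ₗ[ℂ] E :=
    { toFun := fun x => D ⟨a x, h1 x⟩ - a (D x)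
      map_add' := fun x y => by
        have h := D.map_add ⟨a x, h1 x⟩ ⟨a y, h1 y⟩
        have e : (⟨a x, h1 x⟩ + ⟨a y, h1 y⟩ : D.domain) = ⟨a ((x + y : D.domain) : E), h1 (x + y)⟩ :=
          Subtype.ext (by simp)
        rw [e] at h
        rw [h, D.map_add, map_add]; abel
      map_smul' := fun z x => by
        have h := D.map_smul z ⟨a x, h1 x⟩
        have e : (z • ⟨a x, h1 x⟩ : D.domain) = ⟨a ((z • x : D.domain) : E), h1 (z • x)⟩ :=
          Subtype.ext (by simp)
        rw [e] at h
        rw [h, D.map_smul, map_smul, RingHom.id_apply, smul_sub] }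
  let k' : D.domain →L[ℂ] E := k.mkContinuous c h2
  have hde : DenseRange (D.domain.subtypeL) := by
    rw [DenseRange]
    simpa using hD.dense_domain
  have hui : IsUniformInducing (D.domain.subtypeL) := isUniformInducing_val _
  refine ⟨k'.extend D.domain.subtypeL, fun x => ⟨h1 x, ?_⟩, ?_⟩
  · have h := ContinuousLinearMap.extend_eq k' (e := D.domain.subtypeL) hde hui x
    change k'.extend D.domain.subtypeL x = D ⟨a x, h1 x⟩ - a (D x) at h
    rw [h]; abel
  · refine ContinuousLinearMap.opNorm_le_bound _ hc fun x => ?_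
    have hcl : IsClosed {y : E | ‖k'.extend D.domain.subtypeL y‖ ≤ c * ‖y‖} :=
      isClosed_le (by fun_prop) (by fun_prop)
    refine (hcl.closure_subset_iff.2 ?_) (hD.dense_domain x)
    intro y hy
    have h := ContinuousLinearMap.extend_eq k' (e := D.domain.subtypeL) hde hui ⟨y, hy⟩
    change k'.extend D.domain.subtypeL y = k ⟨y, hy⟩ at h
    rw [Set.mem_ofPred_eq, h]
    exact h2 ⟨y, hy⟩

/-- If `a` is invertible and has a bounded commutator with `D`, then so does its inverse. -/
theorem inv (hD : IsSelfAdjoint D) (ha : HasCommutator D a K) {q : E →L[ℂ] E} (h1 : a * q = 1)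
    (h2 : q * a = 1) : HasCommutator D q (-(q * K * q)) := by
  have haq : ∀ x, a (q x) = x := fun x => congrArg (fun T : E →L[ℂ] E => T x) h1
  have hqa : ∀ x, q (a x) = x := fun x => congrArg (fun T : E →L[ℂ] E => T x) h2
  have hmem : ∀ x : D.domain, q x ∈ D.domain := by
    intro y
    -- The formula for the commutator presupposes that `q` preserves `Dom D`. To show this, `y` is
    -- written as `a (res D η z)`. Applying `q (D - iη)` turns the equation into `(1 + q K res D η)
    -- z = q (D - iη) y`, and this `η` makes the perturbation of `1` smaller than `1` in norm.
    set η : ℝ := ‖q * K‖ + 1 with hη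
    have hη0 : 0 < η := by positivity
    have hR : ‖q * K * res D η‖ < 1 := by
      have h3 : ‖res D η‖ ≤ η⁻¹ := by
        refine ContinuousLinearMap.opNorm_le_bound _ (by positivity) fun x => ?_
        have := norm_res_le hD hη0.ne' x
        rwa [abs_of_pos hη0] at this
      calc ‖q * K * res D η‖ ≤ ‖q * K‖ * η⁻¹ :=
            (norm_mul_le _ _).trans (mul_le_mul_of_nonneg_left h3 (norm_nonneg _))
        _ < 1 := by
          rw [mul_inv_lt_iff₀ hη0, one_mul, hη]; linarith
    obtain ⟨u, hu⟩ := isUnit_one_sub_of_norm_lt_one (x := -(q * K * res D η)) (by rwa [norm_neg])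
    rw [sub_neg_eq_add] at hu
    set z : E := (↑u⁻¹ : E →L[ℂ] E) (q (D y - (Complex.I * η) • (y : E))) with hz
    have hz1 : z + q (K (res D η z)) = q (D y - (Complex.I * η) • (y : E)) := by
      have h3 : (u : E →L[ℂ] E) z = q (D y - (Complex.I * η) • (y : E)) := by
        rw [hz, ← mul_apply_eq_comp, Units.mul_inv, one_apply_eq_self]
      rw [hu] at h3
      simpa using h3
    obtain ⟨h4, h5⟩ := res_spec hD hη0.ne' z
    obtain ⟨h6, h7⟩ := ha ⟨_, h4⟩
    have h8 : a (res D η z) = y := by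
      refine eq_of_sub_smul_eq hD hη0.ne' (x := ⟨_, h6⟩) (y := y) ?_
      have h9 := congrArg a hz1
      rw [haq, map_add, haq] at h9
      rw [h7, h5, ← h9, map_add, map_smul]
      abel
    rw [← h8, hqa]
    exact h4
  intro x
  refine ⟨hmem x, ?_⟩
  obtain ⟨h3, h4⟩ := ha ⟨_, hmem x⟩
  have h5 : (⟨a (q x), h3⟩ : D.domain) = x := Subtype.ext (haq x)
  rw [h5] at h4
  rw [h4]
  simp [hqa]

/-- The commutator of an element of `N` with an operator affiliated with `N` lies in `N`. -/
theorem mem {N : VonNeumannAlgebra E} (hN : IsAffiliated N D) (haN : a ∈ N)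
    (ha : HasCommutator D a K) : K ∈ N := by
  have hU : ∀ U ∈ unitary (E →L[ℂ] E), U ∈ N.commutant → K * U = U * K := by
    intro U hU hUN
    refine ContinuousLinearMap.ext fun x => ?_
    have h : Set.EqOn (K * U) (U * K) D.domain := fun x hx => by
      have hc : ∀ y, a (U y) = U (a y) := fun y =>
        congrArg (fun T : E →L[ℂ] E => T y) (VonNeumannAlgebra.mem_commutant_iff.1 hUN a haN)
      obtain ⟨h1, h2⟩ := ha ⟨x, hx⟩
      obtain ⟨h3, h4⟩ := hN.commute U hU hUN ⟨x, hx⟩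
      obtain ⟨h5, h6⟩ := ha ⟨_, h3⟩
      obtain ⟨h7, h8⟩ := hN.commute U hU hUN ⟨_, h1⟩
      have e : (⟨a (U x), h5⟩ : D.domain) = ⟨U (a x), h7⟩ := Subtype.ext (hc x)
      change D ⟨a (U x), h5⟩ = _ at h6
      change D ⟨U (a x), h7⟩ = _ at h8
      rw [e, h8, h2, h4, map_add, hc] at h6
      exact (add_left_cancel h6).symm
    exact congrFun (Continuous.ext_on hN.dense_domain (K * U).continuous (U * K).continuous h) x
  -- By the double commutant theorem it suffices to commute with `N'`, which is spanned by its
  -- unitaries.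
  rw [← VonNeumannAlgebra.commutant_commutant N, VonNeumannAlgebra.mem_commutant_iff]
  intro T hT
  have hcl : IsClosed (N.commutant.toStarSubalgebra : Set (E →L[ℂ] E)) := by
    rw [VonNeumannAlgebra.coe_toStarSubalgebra, VonNeumannAlgebra.coe_commutant]
    exact Set.isClosed_centralizer _
  obtain ⟨u, c, h1, hu⟩ := exists_sum_four_unitary_of_isClosed _ hcl hT
  rw [h1, Finset.sum_mul, Finset.mul_sum]
  refine Finset.sum_congr rfl fun i _ => ?_
  rw [smul_mul_assoc, mul_smul_comm, hU _ (hu i).1 (hu i).2]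

end HasCommutator

end BoundedCommutator

/-! ### Riemann sums for the arctangent integral -/

section Scalar

/-- Mean value theorem, with the decreasing derivative compared to its endpoint values. The two
sides serve right- and left-endpoint sums. -/
theorem arctan_sub_bounds {a b : ℝ} (ha : 0 ≤ a) (hab : a ≤ b) :
    (b - a) / (1 + b ^ 2) ≤ Real.arctan b - Real.arctan a ∧
      Real.arctan b - Real.arctan a ≤ (b - a) / (1 + a ^ 2) := by
  rcases eq_or_lt_of_le hab with rfl | h
  · simp
  obtain ⟨c, ⟨h1, h2⟩, h3⟩ := exists_hasDerivAt_eq_slope Real.arctan (fun x => 1 / (1 + x ^ 2)) h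
    Real.continuous_arctan.continuousOn fun x _ => Real.hasDerivAt_arctan x
  have hba : 0 < b - a := sub_pos.2 h
  have h4 : Real.arctan b - Real.arctan a = (b - a) / (1 + c ^ 2) := by
    rw [eq_div_iff hba.ne'] at h3
    rw [← h3]; ring
  rw [h4]
  constructor
  · gcongr; linarith
  · gcongr

/-- The Riemann sum for `(2 / π) ∫₀^∞ ds / (1 + s² t)` with step `1 / n` and `n²` nodes. -/
noncomputable def riemannSum (n : ℕ) (t : ℝ) : ℝ :=
  (2 / Real.pi * (1 / n)) * ∑ k ∈ Finset.range (n ^ 2), (1 + (((k + 1 : ℕ) : ℝ) / n) ^ 2 * t)⁻¹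

theorem riemannSum_nonneg (n : ℕ) {t : ℝ} (ht : 0 ≤ t) : 0 ≤ riemannSum n t := by
  unfold riemannSum; positivity

theorem continuousOn_riemannSum (n : ℕ) : ContinuousOn (riemannSum n) (Set.Ici 0) := by
  unfold riemannSum
  refine continuousOn_const.mul (continuousOn_finsetSum _ fun k _ => ?_)
  refine ContinuousOn.inv₀ (by fun_prop) fun t ht => ?_
  have : (0 : ℝ) ≤ t := ht
  positivity

/-- The nodes are right endpoints and the integrand decreases, so each rectangle lies below an
increment of `arctan (r s)`; the increments telescope to less than `π/2`. The absence of an error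
term is what makes the final constant exactly `‖C‖`. -/
theorem sqrt_mul_riemannSum_le_one (n : ℕ) {t : ℝ} (ht : 0 ≤ t) :
    √t * riemannSum n t ≤ 1 := by
  set r := √t with hr
  have hr0 : 0 ≤ r := Real.sqrt_nonneg t
  have ht2 : t = r ^ 2 := (Real.sq_sqrt ht).symm
  have hpi := Real.pi_pos
  have h1 : ∑ k ∈ Finset.range (n ^ 2), r * (1 / n) * (1 + (((k + 1 : ℕ) : ℝ) / n) ^ 2 * t)⁻¹ ≤
      Real.pi / 2 := by
    calc _ ≤ ∑ k ∈ Finset.range (n ^ 2), (Real.arctan (r * (((k + 1 : ℕ) : ℝ) / n)) -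
            Real.arctan (r * ((k : ℝ) / n))) := by
          refine Finset.sum_le_sum fun k _ => ?_
          refine le_trans (le_of_eq ?_) (arctan_sub_bounds (a := r * ((k : ℝ) / n))
            (b := r * (((k + 1 : ℕ) : ℝ) / n)) (by positivity) (by push_cast; gcongr; linarith)).1
          rw [ht2, div_eq_mul_inv _ (1 + _)]
          push_cast
          ring_nf
      _ = Real.arctan (r * (((n ^ 2 : ℕ) : ℝ) / n)) - Real.arctan (r * (((0 : ℕ) : ℝ) / n)) :=
          Finset.sum_range_sub (fun k : ℕ => Real.arctan (r * ((k : ℝ) / n))) _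
      _ ≤ Real.pi / 2 := by simpa using (Real.arctan_lt_pi_div_two _).le
  calc r * riemannSum n t = 2 / Real.pi *
        ∑ k ∈ Finset.range (n ^ 2), r * (1 / n) * (1 + (((k + 1 : ℕ) : ℝ) / n) ^ 2 * t)⁻¹ := by
        rw [riemannSum, ← Finset.mul_sum]; ring
    _ ≤ 2 / Real.pi * (Real.pi / 2) := by gcongr
    _ = 1 := by field_simp

/-- Two errors of size `1/n` occur: passing from right to left endpoints costs at most `f 0`, and
truncating at `s = n` costs `π/2 - arctan (r n) = arctan (1/(r n)) ≤ 1/(r n)`. The extra factor `r =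
√t` makes both uniform in `t`. -/
theorem sqrt_sub_mul_riemannSum_le {n : ℕ} (hn : n ≠ 0) {t : ℝ} (ht : 0 ≤ t) (ht1 : t ≤ 1) :
    √t - t * riemannSum n t ≤ 2 / n := by
  set r := √t with hr
  have hr0 : 0 ≤ r := Real.sqrt_nonneg t
  have ht2 : t = r ^ 2 := (Real.sq_sqrt ht).symm
  have hpi := Real.pi_pos
  have hn0 : (0 : ℝ) < n := by positivity
  let f : ℕ → ℝ := fun k => r * (1 / n) * (1 + ((k : ℝ) / n) ^ 2 * t)⁻¹
  have hf : ∑ k ∈ Finset.range (n ^ 2), f (k + 1) = ∑ k ∈ Finset.range (n ^ 2), f k +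
      (f (n ^ 2) - f 0) := by
    have h := Finset.sum_range_sub f (n ^ 2)
    rw [Finset.sum_sub_distrib] at h
    linarith
  have h1 : Real.arctan (r * n) ≤ ∑ k ∈ Finset.range (n ^ 2), f k := by
    calc Real.arctan (r * n) = Real.arctan (r * (((n ^ 2 : ℕ) : ℝ) / n)) -
          Real.arctan (r * (((0 : ℕ) : ℝ) / n)) := by
          have : (((n ^ 2 : ℕ) : ℝ) / n) = n := by push_cast; field_simp
          rw [this]; simp
      _ = ∑ k ∈ Finset.range (n ^ 2), (Real.arctan (r * (((k + 1 : ℕ) : ℝ) / n)) -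
            Real.arctan (r * ((k : ℝ) / n))) :=
          (Finset.sum_range_sub (fun k : ℕ => Real.arctan (r * ((k : ℝ) / n))) _).symm
      _ ≤ _ := by
          refine Finset.sum_le_sum fun k _ => ?_
          refine le_trans (arctan_sub_bounds (a := r * ((k : ℝ) / n))
            (b := r * (((k + 1 : ℕ) : ℝ) / n)) (by positivity)
            (by push_cast; gcongr; linarith)).2 (le_of_eq ?_)
          simp only [f]
          rw [ht2, div_eq_mul_inv _ (1 + _)]
          push_cast
          ring_nf
  have h2 : f 0 = r / n := by simp [f]; ring
  have h3 : 0 ≤ f (n ^ 2) := by simp only [f]; positivity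
  have h4 : r * (Real.pi / 2 - Real.arctan (r * n)) ≤ 1 / n := by
    rcases eq_or_lt_of_le hr0 with h | h
    · rw [← h]; simp
    · rw [← Real.arctan_inv_of_pos (by positivity)]
      have h5 : Real.arctan (r * n)⁻¹ ≤ (r * n)⁻¹ := by
        have := (arctan_sub_bounds le_rfl (b := (r * n)⁻¹) (by positivity)).2
        simpa using this
      calc r * Real.arctan (r * n)⁻¹ ≤ r * (r * n)⁻¹ := by gcongr
        _ = 1 / n := by field_simp
  have h6 : t * riemannSum n t = 2 / Real.pi * (r * ∑ k ∈ Finset.range (n ^ 2), f (k + 1)) := by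
    simp only [f]
    rw [riemannSum, ← Finset.mul_sum, ht2]; push_cast; ring
  have hr1 : r ≤ 1 := Real.sqrt_le_one.2 ht1
  have h7 : r * (Real.pi / 2) - r * ∑ k ∈ Finset.range (n ^ 2), f (k + 1) ≤ 2 / n := by
    rw [hf, h2]
    have h8 : r * (r / n) ≤ 1 / n := by
      rw [mul_div_assoc']
      gcongr
      nlinarith
    have h9 := mul_le_mul_of_nonneg_left h1 hr0
    have h10 := mul_nonneg hr0 h3
    have h11 : (2 : ℝ) / n = 1 / n + 1 / n := by ring
    rw [h11]
    nlinarith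
  calc r - t * riemannSum n t
      = 2 / Real.pi * (r * (Real.pi / 2) - r * ∑ k ∈ Finset.range (n ^ 2), f (k + 1)) := by
        rw [h6]; field_simp
    _ ≤ 2 / Real.pi * (2 / n) := mul_le_mul_of_nonneg_left h7 (by positivity)
    _ ≤ 2 / n := mul_le_of_le_one_left (by positivity) ((div_le_one hpi).2 Real.two_le_pi)

/-- If `γ < q`, then `B (γ/q)^(2^n)` tends to `0` yet stays at least `1`. This removes the constant
left over from the doubling argument in Reid's inequality. -/
theorem le_of_pow_two_pow_le {q γ B : ℝ} (hγ : 0 ≤ γ) (h : ∀ n : ℕ, q ^ 2 ^ n ≤ B * γ ^ 2 ^ n) :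
    q ≤ γ := by
  by_contra! hq
  have hq0 : 0 < q := lt_of_le_of_lt hγ hq
  have h1 : Filter.Tendsto (fun n : ℕ => B * (γ / q) ^ 2 ^ n) Filter.atTop (nhds (B * 0)) :=
    ((tendsto_pow_atTop_nhds_zero_of_lt_one (by positivity) ((div_lt_one hq0).2 hq)).comp
      (tendsto_pow_atTop_atTop_of_one_lt one_lt_two)).const_mul B
  rw [mul_zero] at h1
  obtain ⟨n, hn⟩ := (h1.eventually (gt_mem_nhds one_pos)).exists
  have h2 := h n
  rw [div_pow, mul_div_assoc', div_lt_one (by positivity)] at hn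
  linarith

end Scalar

/-! ### Reid's inequality -/

section Reid

variable {E : Type*} [NormedAddCommGroup E] [InnerProductSpace ℂ E] [CompleteSpace E]

/-- Reid's inequality: an operator `c` that is symmetric for the semi-inner product
`⟪T x, T y⟫` is bounded by `‖c‖` for it. -/
theorem norm_map_le_of_symmetric {T c : E →L[ℂ] E} (hT : IsSelfAdjoint T)
    (h : IsSelfAdjoint (T * T * c)) (x : E) : ‖T (c x)‖ ≤ ‖c‖ * ‖T x‖ := by
  have hcomm : star c * (T * T) = T * T * c := by
    have := h.star_eq
    rwa [star_mul, star_mul, hT.star_eq] at this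
  have hpow : ∀ j : ℕ, star (c ^ j) * (T * T) = T * T * c ^ j := by
    intro j
    induction j with
    | zero => simp
    | succ j ih => rw [pow_succ', star_mul, mul_assoc, hcomm, ← mul_assoc, ih, mul_assoc,
        ← pow_succ, pow_succ']
  have hTi : ∀ u v, ⟪T u, v⟫_ℂ = ⟪u, T v⟫_ℂ := fun u v => by
    conv_lhs => rw [← hT.star_eq, ContinuousLinearMap.star_eq_adjoint,
      ContinuousLinearMap.adjoint_inner_left]
  -- Cauchy–Schwarz for the semi-inner product, for which `c ^ j` is symmetric; each use doubles the
  -- exponent.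
  have hstep : ∀ j : ℕ, ‖T ((c ^ j) x)‖ ^ 2 ≤ ‖T ((c ^ (j + j)) x)‖ * ‖T x‖ := by
    intro j
    have h1 : ⟪T ((c ^ j) x), T ((c ^ j) x)⟫_ℂ = ⟪T x, T ((c ^ (j + j)) x)⟫_ℂ := by
      have h2 := congrArg (fun A : E →L[ℂ] E => A ((c ^ j) x)) (hpow j)
      simp only [mul_apply_eq_comp] at h2
      rw [hTi, ← ContinuousLinearMap.adjoint_inner_right, ← ContinuousLinearMap.star_eq_adjoint,
        h2, ← hTi, pow_add, mul_apply_eq_comp]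
    have h3 : ‖T ((c ^ j) x)‖ ^ 2 = ‖⟪T ((c ^ j) x), T ((c ^ j) x)⟫_ℂ‖ := by
      rw [inner_self_eq_norm_sq_to_K]; simp
    rw [h3, h1, mul_comm]
    exact norm_inner_le_norm _ _
  have hiter : ∀ n : ℕ, ‖T (c x)‖ ^ 2 ^ n * ‖T x‖ ≤ ‖T ((c ^ 2 ^ n) x)‖ * ‖T x‖ ^ 2 ^ n := by
    intro n
    induction n with
    | zero => simp
    | succ n ih =>
      rcases eq_or_lt_of_le (norm_nonneg (T x)) with h0 | h0
      · rw [← h0]; simp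
      have h1 := hstep (2 ^ n)
      have h2 : (‖T (c x)‖ ^ 2 ^ n * ‖T x‖) ^ 2 ≤
          (‖T ((c ^ 2 ^ n) x)‖ * ‖T x‖ ^ 2 ^ n) ^ 2 := by gcongr
      have e : 2 ^ n + 2 ^ n = 2 ^ (n + 1) := by ring
      rw [e] at h1
      refine le_of_mul_le_mul_right ?_ h0
      calc ‖T (c x)‖ ^ 2 ^ (n + 1) * ‖T x‖ * ‖T x‖ = (‖T (c x)‖ ^ 2 ^ n * ‖T x‖) ^ 2 := by
            rw [pow_succ 2 n, pow_mul]; ring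
        _ ≤ (‖T ((c ^ 2 ^ n) x)‖ * ‖T x‖ ^ 2 ^ n) ^ 2 := h2
        _ = ‖T ((c ^ 2 ^ n) x)‖ ^ 2 * ‖T x‖ ^ 2 ^ (n + 1) := by
            rw [pow_succ 2 n, pow_mul ‖T x‖]; ring
        _ ≤ ‖T ((c ^ 2 ^ (n + 1)) x)‖ * ‖T x‖ * ‖T x‖ ^ 2 ^ (n + 1) := by gcongr
        _ = _ := by ring
  rcases eq_or_lt_of_le (norm_nonneg (T x)) with h0 | h0
  · have h1 := hstep 1
    rw [← h0, mul_zero, pow_one] at h1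
    rw [← h0, mul_zero]
    nlinarith [norm_nonneg (T (c x))]
  rw [← div_le_iff₀ h0]
  -- The crude bound `‖T (c^N x)‖ ≤ ‖T‖ ‖c‖^N ‖x‖` costs a factor independent of `N = 2 ^ n`.
  refine le_of_pow_two_pow_le (B := ‖T‖ * ‖x‖ / ‖T x‖) (norm_nonneg _) fun n => ?_
  have h1 : ‖T ((c ^ 2 ^ n) x)‖ ≤ ‖T‖ * (‖c‖ ^ 2 ^ n * ‖x‖) :=
    (T.le_opNorm _).trans (by
      gcongr
      exact ((c ^ 2 ^ n).le_opNorm x).trans (by gcongr; exact norm_pow_le' c (by positivity)))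
  rw [div_pow, div_le_iff₀ (by positivity)]
  refine le_of_mul_le_mul_right ((hiter n).trans ?_) h0
  calc ‖T ((c ^ 2 ^ n) x)‖ * ‖T x‖ ^ 2 ^ n ≤ ‖T‖ * (‖c‖ ^ 2 ^ n * ‖x‖) * ‖T x‖ ^ 2 ^ n := by gcongr
    _ = _ := by field_simp

end Reid

/-! ### Resolvents and `(1 + H²)^(-1/2)` -/

section Transform

variable {E : Type*} [NormedAddCommGroup E] [InnerProductSpace ℂ E] [CompleteSpace E]

theorem invOneAddSq_apply {H : E →ₗ.[ℂ] E} (hH : IsSelfAdjoint H) (x : E) :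
    ∃ (h : invOneAddSq H x ∈ H.domain) (h' : H ⟨invOneAddSq H x, h⟩ ∈ H.domain),
      invOneAddSq H x + H ⟨H ⟨invOneAddSq H x, h⟩, h'⟩ = x := by
  have hs := invOneAddSq_spec hH.isClosed hH.dense_domain
  have hx : x ∈ (oneAddSq H).inverse.domain := by rw [← hs]; trivial
  have hx' := hx
  rw [LinearPMap.inverse_domain] at hx'
  obtain ⟨⟨y, hyd⟩, hy⟩ := hx'
  have e : invOneAddSq H x = y := by
    obtain ⟨-, h⟩ := LinearPMap.ext_iff.1 hs
    exact (h (x := x) (hf := trivial) (hg := hx)).trans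
      (LinearPMap.inverse_apply_eq (oneAddSq_ker hH.dense_domain) (x := ⟨y, hyd⟩)
        (y := ⟨x, hx⟩) hy)
  obtain ⟨h1, h2⟩ := mem_pcomp_domain.1 (show y ∈ (pcomp H.adjoint H).domain from hyd)
  have h3 : y + H.adjoint ⟨H ⟨y, h1⟩, h2⟩ = x := hy
  obtain ⟨h4, h5⟩ := LinearPMap.ext_iff.1 (LinearPMap.isSelfAdjoint_def.1 hH)
  have h6 : H ⟨y, h1⟩ ∈ H.domain := h4.le h2
  rw [e]
  exact ⟨h1, h6, by rw [← h3, h5 (hf := h2) (hg := h6)]⟩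

theorem res_sub_res {H : E →ₗ.[ℂ] E} (hH : IsSelfAdjoint H) {μ ν : ℝ} (hμ : μ ≠ 0) (hν : ν ≠ 0) :
    res H μ - res H ν = (Complex.I * (μ - ν)) • (res H μ * res H ν) := by
  refine ContinuousLinearMap.ext fun x => ?_
  obtain ⟨h1, h2⟩ := res_spec hH hν x
  have h := res_eq_of_map hH hμ (x := x - (Complex.I * (μ - ν)) • res H ν x) h1 (by
    rw [h2, mul_sub, sub_smul]; abel)
  rw [map_sub, map_smul] at h
  simp only [sub_apply, smul_apply, mul_apply_eq_comp]
  rw [sub_eq_iff_eq_add] at h ⊢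
  rw [h, add_comm]

theorem res_commute {H : E →ₗ.[ℂ] E} (hH : IsSelfAdjoint H) {μ ν : ℝ} (hμ : μ ≠ 0) (hν : ν ≠ 0) :
    Commute (res H μ) (res H ν) := by
  rcases eq_or_ne μ ν with rfl | h
  · exact Commute.refl _
  have h1 := res_sub_res hH hμ hν
  have h2 := res_sub_res hH hν hμ
  have hc : Complex.I * ((μ : ℂ) - ν) ≠ 0 :=
    mul_ne_zero Complex.I_ne_zero (sub_ne_zero.2 (by exact_mod_cast h))
  refine smul_right_injective _ hc ?_
  simp only
  rw [← h1, ← neg_sub (res H ν), h2, ← neg_smul]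
  congr 1; ring

theorem res_one_mul_res_neg_one {H : E →ₗ.[ℂ] E} (hH : IsSelfAdjoint H) :
    res H 1 * res H (-1) = invOneAddSq H := by
  refine ContinuousLinearMap.ext fun x => ?_
  obtain ⟨h1, h2, h3⟩ := invOneAddSq_apply hH x
  have h4 : res H (-1) x = H ⟨_, h1⟩ - Complex.I • invOneAddSq H x := by
    refine res_eq_of_map hH (by norm_num)
      (H.domain.sub_mem h2 (H.domain.smul_mem Complex.I h1)) ?_
    have h5 := H.map_sub ⟨_, h2⟩ (Complex.I • ⟨_, h1⟩)
    rw [H.map_smul] at h5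
    refine h5.trans ?_
    nth_rw 3 [← h3]
    rw [smul_sub, smul_smul]
    have : Complex.I * ((-1 : ℝ) : ℂ) * Complex.I = 1 := by
      push_cast; linear_combination -Complex.I_mul_I
    rw [this, one_smul, add_comm (invOneAddSq H x)]
    push_cast
    rw [mul_neg_one, neg_smul]
    abel
  rw [mul_apply_eq_comp, h4]
  refine res_eq_of_map hH one_ne_zero h1 ?_
  push_cast; rw [mul_one]; abel

theorem isSelfAdjoint_invOneAddSq {H : E →ₗ.[ℂ] E} (hH : IsSelfAdjoint H) :
    IsSelfAdjoint (invOneAddSq H) :=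
  IsSelfAdjoint.of_nonneg (invOneAddSq_nonneg hH.isClosed hH.dense_domain)

theorem invSqrt_mul_self {H : E →ₗ.[ℂ] E} (hH : IsSelfAdjoint H) :
    invSqrtOneAddSq H * invSqrtOneAddSq H = invOneAddSq H :=
  CFC.sqrt_mul_sqrt_self _ (invOneAddSq_nonneg hH.isClosed hH.dense_domain)

theorem isSelfAdjoint_invSqrt (H : E →ₗ.[ℂ] E) : IsSelfAdjoint (invSqrtOneAddSq H) :=
  IsSelfAdjoint.of_nonneg (CFC.sqrt_nonneg _)

theorem res_commute_invSqrt {H : E →ₗ.[ℂ] E} (hH : IsSelfAdjoint H) {μ : ℝ} (hμ : μ ≠ 0) :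
    Commute (res H μ) (invSqrtOneAddSq H) := by
  have h : Commute (invOneAddSq H) (res H μ) := by
    rw [← res_one_mul_res_neg_one hH]
    exact (res_commute hH one_ne_zero hμ).mul_left (res_commute hH (by norm_num) hμ)
  rw [invSqrtOneAddSq, CFC.sqrt_eq_real_sqrt _ (invOneAddSq_nonneg hH.isClosed hH.dense_domain)]
  exact (h.cfcₙ_real _).symm

theorem invSqrt_injective {H : E →ₗ.[ℂ] E} (hH : IsSelfAdjoint H) :
    Function.Injective (invSqrtOneAddSq H) := by
  rw [injective_iff_map_eq_zero]
  intro x hx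
  obtain ⟨h1, h2, h3⟩ := invOneAddSq_apply hH x
  have h4 : invOneAddSq H x = 0 := by
    rw [← invSqrt_mul_self hH, mul_apply_eq_comp, hx, map_zero]
  have h5 : (⟨invOneAddSq H x, h1⟩ : H.domain) = 0 := Subtype.ext h4
  have h6 : (⟨H ⟨invOneAddSq H x, h1⟩, h2⟩ : H.domain) = 0 := Subtype.ext (by
    change H ⟨invOneAddSq H x, h1⟩ = 0
    rw [h5, H.map_zero])
  rw [h6, H.map_zero, h4, add_zero] at h3
  exact h3.symm

/-- An injective self-adjoint operator has dense range. Hence `S` can be cancelled on either side,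
and identities for `m` can be read off from those for `m S`. -/
theorem denseRange_invSqrt {H : E →ₗ.[ℂ] E} (hH : IsSelfAdjoint H) :
    DenseRange (invSqrtOneAddSq H) := by
  have h : (LinearMap.range (invSqrtOneAddSq H).toLinearMap).topologicalClosure = ⊤ := by
    rw [Submodule.topologicalClosure_eq_top_iff, Submodule.eq_bot_iff]
    intro y hy
    refine (injective_iff_map_eq_zero _).1 (invSqrt_injective hH) y ?_
    have h1 := (Submodule.mem_orthogonal' _ _).1 hy _ ⟨invSqrtOneAddSq H y, rfl⟩
    rw [← inner_self_eq_zero (𝕜 := ℂ)]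
    nth_rw 1 [← (isSelfAdjoint_invSqrt H).star_eq]
    rw [ContinuousLinearMap.star_eq_adjoint, ContinuousLinearMap.adjoint_inner_left]
    exact h1
  have h2 := (Submodule.dense_iff_topologicalClosure_eq_top).2 h
  exact h2

/-- `(H - iμ)⁻¹ (1 + (μ² - 1) G) = H G + iμ G`, where `G = (1 + H²)⁻¹`. -/
theorem res_mul_one_add {H : E →ₗ.[ℂ] E} (hH : IsSelfAdjoint H) {m : E →L[ℂ] E}
    (hm : boundedTransform H = ofBounded m) {μ : ℝ} (hμ : μ ≠ 0) :
    res H μ * (1 + ((μ : ℂ) ^ 2 - 1) • invOneAddSq H) =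
      m * invSqrtOneAddSq H + (Complex.I * μ) • invOneAddSq H := by
  refine ContinuousLinearMap.ext fun x => ?_
  obtain ⟨h1, h2, h3⟩ := invOneAddSq_apply hH x
  have h4 : m (invSqrtOneAddSq H x) = H ⟨_, h1⟩ := by
    obtain ⟨h5, h6⟩ := LinearPMap.ext_iff.1 hm
    have h7 : invSqrtOneAddSq H x ∈ (boundedTransform H).domain := by rw [h5]; trivial
    have h8 := h6 (x := invSqrtOneAddSq H x) (hf := h7) (hg := trivial)
    obtain ⟨h9, h10⟩ := mem_pcomp_domain.1 h7
    have h11 : H ⟨invSqrtOneAddSq H (invSqrtOneAddSq H x), h10⟩ = m (invSqrtOneAddSq H x) := h8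
    rw [← h11]
    exact congrArg H (Subtype.ext
      (congrArg (fun T : E →L[ℂ] E => T x) (invSqrt_mul_self hH)))
  simp only [mul_apply_eq_comp, add_apply, smul_apply, one_apply_eq_self]
  rw [h4]
  refine res_eq_of_map hH hμ (H.domain.add_mem h2 (H.domain.smul_mem (Complex.I * μ) h1)) ?_
  have h5 := H.map_add ⟨_, h2⟩ ((Complex.I * (μ : ℂ)) • ⟨_, h1⟩)
  rw [H.map_smul] at h5
  refine h5.trans ?_
  have h6 : H ⟨H ⟨_, h1⟩, h2⟩ = x - invOneAddSq H x := eq_sub_of_add_eq' h3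
  rw [h6, smul_add, smul_smul]
  have e : Complex.I * (μ : ℂ) * (Complex.I * μ) = -(μ : ℂ) ^ 2 := by
    linear_combination (μ : ℂ) ^ 2 * Complex.I_mul_I
  rw [e]
  module

end Transform

/-! ### Algebraic properties of the bounded transform -/

section BoundedTransform

variable {E : Type*} [NormedAddCommGroup E] [InnerProductSpace ℂ E]

theorem eq_of_mul_right_eq {S A B : E →L[ℂ] E} (hS : DenseRange S) (h : A * S = B * S) : A = B := by
  refine ContinuousLinearMap.ext fun x => congrFun (hS.equalizer A.continuous B.continuous ?_) x
  funext x
  exact congrArg (fun T : E →L[ℂ] E => T x) h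

theorem eq_of_mul_left_eq {S A B : E →L[ℂ] E} (hS : Function.Injective S) (h : S * A = S * B) :
    A = B :=
  ContinuousLinearMap.ext fun x => hS (congrArg (fun T : E →L[ℂ] E => T x) h)

variable [CompleteSpace E] {H : E →ₗ.[ℂ] E} {m : E →L[ℂ] E}

theorem res_one_eq (hH : IsSelfAdjoint H) (hm : boundedTransform H = ofBounded m) :
    res H 1 = m * invSqrtOneAddSq H + Complex.I • invOneAddSq H := by
  simpa using res_mul_one_add hH hm one_ne_zero

theorem res_neg_one_eq (hH : IsSelfAdjoint H) (hm : boundedTransform H = ofBounded m) :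
    res H (-1) = m * invSqrtOneAddSq H - Complex.I • invOneAddSq H := by
  simpa [sub_eq_add_neg] using res_mul_one_add hH hm (μ := -1) (by norm_num)

/-- `m S = R 1 - i S²` visibly commutes with `S`; then `S` is cancelled on the right. -/
theorem invSqrt_commute_transform (hH : IsSelfAdjoint H) (hm : boundedTransform H = ofBounded m) :
    invSqrtOneAddSq H * m = m * invSqrtOneAddSq H := by
  refine eq_of_mul_right_eq (denseRange_invSqrt hH) ?_
  have h1 : m * invSqrtOneAddSq H =
      res H 1 - Complex.I • (invSqrtOneAddSq H * invSqrtOneAddSq H) := by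
    rw [invSqrt_mul_self hH, res_one_eq hH hm, add_sub_cancel_right]
  rw [mul_assoc, h1]
  exact ((res_commute_invSqrt hH one_ne_zero).symm.sub_right
    (((Commute.refl _).mul_right (Commute.refl _)).smul_right _)).eq

/-- Comparing `(R 1)* = R (-1)` term by term gives `S m* = m S = S m`. -/
theorem isSelfAdjoint_transform (hH : IsSelfAdjoint H) (hm : boundedTransform H = ofBounded m) :
    IsSelfAdjoint m := by
  refine eq_of_mul_left_eq (invSqrt_injective hH) ?_
  have h1 := res_star hH one_ne_zero
  rw [res_one_eq hH hm, res_neg_one_eq hH hm, star_add, star_smul,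
    (isSelfAdjoint_invOneAddSq hH).star_eq, star_mul, (isSelfAdjoint_invSqrt H).star_eq] at h1
  simp only [RCLike.star_def, Complex.conj_I, neg_smul, ← sub_eq_add_neg, sub_left_inj] at h1
  rw [h1, invSqrt_commute_transform hH hm]

/-- Expanding `(m S + i S²)(m S - i S²) = R 1 R (-1) = S²`, the mixed terms cancel by commutativity,
and two factors `S` are removed. -/
theorem transform_sq_add (hH : IsSelfAdjoint H) (hm : boundedTransform H = ofBounded m) :
    m * m + invSqrtOneAddSq H * invSqrtOneAddSq H = 1 := by
  refine eq_of_mul_right_eq (denseRange_invSqrt hH) (eq_of_mul_right_eq (denseRange_invSqrt hH) ?_)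
  have h := res_one_mul_res_neg_one hH
  have hc := invSqrt_commute_transform hH hm
  rw [res_one_eq hH hm, res_neg_one_eq hH hm, ← invSqrt_mul_self hH] at h
  set S := invSqrtOneAddSq H
  have e1 : m * S * (m * S) = m * m * (S * S) := by
    rw [mul_assoc, ← mul_assoc S, hc]; simp only [mul_assoc]
  have e2 : m * S * (S * S) = S * S * (m * S) := by
    rw [mul_assoc S, ← mul_assoc S m S, hc, ← mul_assoc, ← mul_assoc, ← mul_assoc, hc, mul_assoc,
      mul_assoc]
  rw [one_mul, mul_assoc, add_mul, ← e1]
  rw [add_mul, mul_sub, mul_sub, mul_smul_comm, smul_mul_assoc, e2, smul_mul_assoc, mul_smul_comm,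
    smul_smul, Complex.I_mul_I, neg_one_smul, sub_neg_eq_add] at h
  refine Eq.trans ?_ h
  abel

theorem invOneAddSq_le_one (hH : IsSelfAdjoint H) (hm : boundedTransform H = ofBounded m) :
    invOneAddSq H ≤ 1 := by
  rw [← transform_sq_add hH hm, ← invSqrt_mul_self hH]
  refine le_add_of_nonneg_left ?_
  have h := star_mul_self_nonneg m
  rwa [(isSelfAdjoint_transform hH hm).star_eq] at h

/-- `m + i S` is an isometry with `S (m + i S) = (H - i)⁻¹`. -/
theorem exists_isometry (hH : IsSelfAdjoint H) (hm : boundedTransform H = ofBounded m) :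
    ∃ φ : E →L[ℂ] E, ‖φ‖ ≤ 1 ∧ invSqrtOneAddSq H * φ = res H 1 := by
  have hc := invSqrt_commute_transform hH hm
  have h1 := transform_sq_add hH hm
  have h2 : star (m + Complex.I • invSqrtOneAddSq H) * (m + Complex.I • invSqrtOneAddSq H) = 1 := by
    rw [star_add, star_smul, (isSelfAdjoint_transform hH hm).star_eq,
      (isSelfAdjoint_invSqrt H).star_eq, ← h1]
    simp only [RCLike.star_def, Complex.conj_I, neg_smul, add_mul, mul_add, mul_smul_comm,
      smul_mul_assoc, neg_mul, smul_add, smul_neg, hc, smul_smul, Complex.I_mul_I, one_smul]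
    abel
  refine ⟨m + Complex.I • invSqrtOneAddSq H, ?_, ?_⟩
  · have h3 := CStarRing.norm_star_mul_self (x := m + Complex.I • invSqrtOneAddSq H)
    rw [h2] at h3
    have h4 : ‖(1 : E →L[ℂ] E)‖ ≤ 1 := ContinuousLinearMap.norm_id_le
    nlinarith [norm_nonneg (m + Complex.I • invSqrtOneAddSq H)]
  · rw [mul_add, hc, mul_smul_comm, invSqrt_mul_self hH, res_one_eq hH hm]

end BoundedTransform

/-! ### Commutators of `D` with resolvents of `H` -/

section Derivation

variable {E : Type*} [NormedAddCommGroup E] [InnerProductSpace ℂ E] [CompleteSpace E]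
variable {D H : E →ₗ.[ℂ] E}

/-- For `x` in the core and `y = R μ x`, expanding `D x = D (H - iμ) y` gives `(H - iμ) D y = D x -
C x`, hence `D y = R μ (D x - C x)`. The core then carries the identity to `Dom D`. -/
theorem hasCommutator_res {N : VonNeumannAlgebra E} (hD : IsSelfAdjoint D) (hH : IsSelfAdjoint H)
    {V : Submodule ℂ E} (hV : IsDifferentiableOnCore N D H V) {μ : ℝ} (hμ : μ ≠ 0)
    {C : E →L[ℂ] E}
    (hC : ExtendsFrom (pcomp (commutator D H) (resolvent H (Complex.I * μ))) V C) :
    HasCommutator D (res H μ) (-(res H μ * C)) := by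
  refine HasCommutator.of_core hD.isClosed hV.hasCore fun x hx => ?_
  obtain ⟨h1, h2⟩ := res_spec hH hμ x
  obtain ⟨hx1, hx2⟩ := resolvent_eq hH hμ x
  obtain ⟨h3, h4⟩ := hC x hx
  obtain ⟨h5, h6⟩ := mem_pcomp_domain.1 h3
  have h7 : commutator D H ⟨_, h6⟩ = C x := h4
  have key : ∀ y (hy : y ∈ (commutator D H).domain), y = res H μ x →
      commutator D H ⟨y, hy⟩ = C x →
      ∃ h : res H μ x ∈ D.domain,
        D ⟨res H μ x, h⟩ = res H μ (D ⟨x, hV.hasCore.le_domain hx⟩) + (-(res H μ * C)) x := by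
    rintro y hy rfl hyC
    obtain ⟨h8, h9⟩ := mem_pcomp_domain.1 hy.1
    obtain ⟨h10, h11⟩ := mem_pcomp_domain.1 hy.2
    have h12 : D ⟨H ⟨res H μ x, h8⟩, h9⟩ - H ⟨D ⟨res H μ x, h10⟩, h11⟩ = C x := hyC
    refine ⟨h10, ?_⟩
    have e : (⟨H ⟨res H μ x, h8⟩, h9⟩ : D.domain) =
        ⟨x, hV.hasCore.le_domain hx⟩ + (Complex.I * μ) • ⟨res H μ x, h10⟩ := Subtype.ext h2
    rw [e, D.map_add, D.map_smul] at h12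
    have h13 := res_eq_of_map hH hμ
      (x := D ⟨x, hV.hasCore.le_domain hx⟩ - C x) (y := D ⟨res H μ x, h10⟩) h11 (by
        rw [← h12]; abel)
    rw [← h13, map_sub, neg_apply, mul_apply_eq_comp, sub_eq_add_neg]
  exact key _ h6 hx2 h7

end Derivation

/-! ### Reduction of all commutators to `(H - i)⁻¹ C` -/

section Cayley

variable {E : Type*} [NormedAddCommGroup E] [InnerProductSpace ℂ E] [CompleteSpace E]
variable {D H : E →ₗ.[ℂ] E}

/-- The bounded operator `(H + i) (H - iμ)⁻¹`. -/
noncomputable def cayley (H : E →ₗ.[ℂ] E) (μ : ℝ) : E →L[ℂ] E :=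
  1 + (Complex.I * (μ + 1)) • res H μ

theorem star_cayley_neg (hH : IsSelfAdjoint H) {μ : ℝ} (hμ : μ ≠ 0) :
    star (cayley H (-μ)) = 1 + (Complex.I * (μ - 1)) • res H μ := by
  rw [cayley, star_add, star_one, star_smul, res_star hH (neg_ne_zero.2 hμ), neg_neg]
  congr 2
  simp only [RCLike.star_def, map_mul, map_add, Complex.conj_I, map_one, Complex.conj_ofReal]
  push_cast; ring

theorem star_cayley_neg_mul_res_one (hH : IsSelfAdjoint H) {μ : ℝ} (hμ : μ ≠ 0) :
    star (cayley H (-μ)) * res H 1 = res H μ := by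
  have h := res_sub_res hH hμ one_ne_zero
  rw [star_cayley_neg hH hμ, add_mul, one_mul, smul_mul_assoc, ← Complex.ofReal_one, ← h]
  abel

theorem cayley_mul_res_neg_one (hH : IsSelfAdjoint H) {μ : ℝ} (hμ : μ ≠ 0) :
    cayley H μ * res H (-1) = res H μ := by
  have h := res_sub_res hH hμ (ν := -1) (by norm_num)
  rw [Complex.ofReal_neg, Complex.ofReal_one, sub_neg_eq_add] at h
  rw [cayley, add_mul, one_mul, smul_mul_assoc, ← h]
  abel

theorem one_sub_mul_cayley (hH : IsSelfAdjoint H) {μ : ℝ} (hμ : μ ≠ 0) :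
    (1 - (Complex.I * (μ + 1)) • res H (-1)) * cayley H μ = 1 := by
  have h := cayley_mul_res_neg_one hH hμ
  have hc : Commute (res H (-1)) (cayley H μ) :=
    (Commute.one_right _).add_right ((res_commute hH (by norm_num) hμ).smul_right _)
  rw [sub_mul, one_mul, smul_mul_assoc, hc.eq, h, cayley, add_sub_cancel_right]

/-- `[D, (H - iμ)⁻¹]` in terms of `[D, (H + i)⁻¹] = -(H + i)⁻¹ C`. -/
theorem hasCommutator_res_of_neg_one (hD : IsSelfAdjoint D) (hH : IsSelfAdjoint H)
    {C K : E →L[ℂ] E} {μ : ℝ} (hμ : μ ≠ 0)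
    (h1 : HasCommutator D (res H (-1)) (-(res H (-1) * C))) (hK : HasCommutator D (res H μ) K) :
    HasCommutator D (res H μ) (-(star (cayley H (-μ)) * (res H 1 * C) * cayley H μ)) := by
  have h2 := res_sub_res hH hμ (ν := -1) (by norm_num)
  rw [Complex.ofReal_neg, Complex.ofReal_one, sub_neg_eq_add] at h2
  have h3 := hK.sub h1
  rw [h2] at h3
  -- The derivation rule applied to `R μ - R (-1) = i(μ + 1) R μ R (-1)` is a linear equation for
  -- `K`, solvable because `1 - i(μ + 1) R (-1)` is inverse to `cayley H μ`.
  have h4 := h3.unique hD.dense_domain ((hK.mul h1).smul (Complex.I * (μ + 1)))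
  have h5 : K * (1 - (Complex.I * (μ + 1)) • res H (-1)) =
      -(cayley H μ * res H (-1) * C) := by
    rw [cayley, mul_sub, mul_one, mul_smul_comm, add_mul, add_mul, one_mul, smul_mul_assoc,
      smul_mul_assoc, mul_assoc (res H μ)]
    rw [smul_add, sub_neg_eq_add, mul_neg, smul_neg] at h4
    rw [← sub_eq_zero] at h4 ⊢
    refine Eq.trans ?_ h4
    abel
  have h6 : K = -(star (cayley H (-μ)) * (res H 1 * C) * cayley H μ) := by
    calc K = K * ((1 - (Complex.I * (μ + 1)) • res H (-1)) * cayley H μ) := by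
          rw [one_sub_mul_cayley hH hμ, mul_one]
      _ = _ := by
          rw [← mul_assoc, h5, cayley_mul_res_neg_one hH hμ, ← mul_assoc,
            star_cayley_neg_mul_res_one hH hμ, neg_mul]
  rwa [← h6]

/-- Formally `(H - i)⁻¹ [D,H] (H + i)⁻¹` is skew because `[D,H]` is. Rigorously, `[D, R 1]` is
computed both as an adjoint of `[D, R (-1)]` and from the general formula at `μ = 1`; the factor
`cayley H 1` is then inverted. -/
theorem star_res_one_mul (hD : IsSelfAdjoint D) (hH : IsSelfAdjoint H) {C : E →L[ℂ] E}
    (h1 : HasCommutator D (res H (-1)) (-(res H (-1) * C))) :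
    star (res H 1 * C) = -(res H 1 * C) := by
  have h2 := h1.star hD
  have hs : star (res H (-1)) = res H 1 := by rw [res_star hH (by norm_num), neg_neg]
  rw [hs, star_neg, neg_neg, star_mul, hs] at h2
  have h3 := h2.unique hD.dense_domain (hasCommutator_res_of_neg_one hD hH one_ne_zero h1 h2)
  have hA : star (cayley H (-1)) = 1 := by rw [star_cayley_neg hH one_ne_zero]; simp
  rw [hA, one_mul] at h3
  have hcomm : Commute (cayley H 1) (1 - (Complex.I * ((1 : ℝ) + 1)) • res H (-1)) :=
    (Commute.one_right _).sub_right
      (((Commute.one_left _).add_left ((res_commute hH one_ne_zero (by norm_num)).smul_left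
        _)).smul_right _)
  have h4 : cayley H 1 * (1 - (Complex.I * ((1 : ℝ) + 1)) • res H (-1)) = 1 := by
    rw [hcomm.eq, one_sub_mul_cayley hH one_ne_zero]
  have h5 : res H 1 * (1 - (Complex.I * ((1 : ℝ) + 1)) • res H (-1)) = res H (-1) := by
    have := res_sub_res hH (μ := 1) (ν := -1) one_ne_zero (by norm_num)
    rw [Complex.ofReal_neg, Complex.ofReal_one, sub_neg_eq_add] at this
    rw [mul_sub, mul_one, mul_smul_comm, Complex.ofReal_one, ← this]
    abel
  have h6 := congrArg (· * (1 - (Complex.I * ((1 : ℝ) + 1)) • res H (-1))) h3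
  rw [mul_assoc, h5, neg_mul, mul_assoc _ (cayley H 1), h4, mul_one] at h6
  rw [star_mul, res_star hH one_ne_zero, h6]

/-- The operator `(H² + 1) (H² + μ²)⁻¹`. -/
noncomputable def cayleySq (H : E →ₗ.[ℂ] E) (μ : ℝ) : E →L[ℂ] E :=
  1 - ((μ : ℂ) ^ 2 - 1) • (res H (-μ) * res H μ)

theorem cayleySq_neg (hH : IsSelfAdjoint H) {μ : ℝ} (hμ : μ ≠ 0) :
    cayleySq H (-μ) = cayleySq H μ := by
  rw [cayleySq, cayleySq, neg_neg, (res_commute hH hμ (neg_ne_zero.2 hμ)).eq]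
  push_cast; rw [neg_sq]

theorem star_cayley (hH : IsSelfAdjoint H) {μ : ℝ} (hμ : μ ≠ 0) :
    star (cayley H μ) = 1 - (Complex.I * (μ + 1)) • res H (-μ) := by
  have h := star_cayley_neg hH (neg_ne_zero.2 hμ)
  rw [neg_neg] at h
  rw [h, sub_eq_add_neg (1 : E →L[ℂ] E), ← neg_smul]
  congr 2
  push_cast; ring

theorem res_sub_res_neg (hH : IsSelfAdjoint H) {μ : ℝ} (hμ : μ ≠ 0) :
    res H μ - res H (-μ) = (2 * Complex.I * μ) • (res H (-μ) * res H μ) := by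
  have h := res_sub_res hH hμ (neg_ne_zero.2 hμ)
  rw [h, (res_commute hH hμ (neg_ne_zero.2 hμ)).eq]
  congr 1
  push_cast; ring

theorem star_cayley_mul_cayley (hH : IsSelfAdjoint H) {μ : ℝ} (hμ : μ ≠ 0) :
    star (cayley H μ) * cayley H μ = cayleySq H μ := by
  have h := res_sub_res_neg hH hμ
  rw [sub_eq_iff_eq_add] at h
  have e : Complex.I * ((μ : ℂ) + 1) * (Complex.I * (μ + 1)) = -(μ + 1) ^ 2 := by
    linear_combination ((μ : ℂ) + 1) ^ 2 * Complex.I_mul_I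
  have e2 : Complex.I * ((μ : ℂ) + 1) * (2 * Complex.I * μ) = -(2 * μ * (μ + 1)) := by
    linear_combination (2 * (μ : ℂ) * (μ + 1)) * Complex.I_mul_I
  rw [star_cayley hH hμ, cayley, cayleySq]
  generalize Complex.I * ((μ : ℂ) + 1) = c at e e2
  have h' : c • res H μ = (-(2 * μ * (μ + 1)) : ℂ) • (res H (-μ) * res H μ) +
      c • res H (-μ) := by
    conv_lhs => rw [h]
    rw [smul_add, smul_smul, e2]
  rw [sub_mul, one_mul, mul_add, mul_one, smul_mul_smul_comm, e, h']
  module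

/-- The second factor is `(H² + μ²) G`. The identity makes `cayleySq H μ` a function of the bounded
operator `G`, to which continuous functional calculus applies. -/
theorem cayleySq_mul (hH : IsSelfAdjoint H) {m : E →L[ℂ] E}
    (hm : boundedTransform H = ofBounded m) {μ : ℝ} (hμ : μ ≠ 0) :
    cayleySq H μ * (1 + ((μ : ℂ) ^ 2 - 1) • invOneAddSq H) = 1 := by
  have h1 := res_mul_one_add hH hm hμ
  have h2 := res_mul_one_add hH hm (neg_ne_zero.2 hμ)
  rw [Complex.ofReal_neg, neg_sq] at h2
  have h3 := congrArg (· * (1 + ((μ : ℂ) ^ 2 - 1) • invOneAddSq H)) (res_sub_res_neg hH hμ)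
  simp only [sub_mul] at h3
  rw [h1, h2, smul_mul_assoc] at h3
  have h4 : res H (-μ) * res H μ * (1 + ((μ : ℂ) ^ 2 - 1) • invOneAddSq H) = invOneAddSq H := by
    have hc : (2 * Complex.I * (μ : ℂ)) ≠ 0 := by simp [hμ]
    refine smul_right_injective _ hc ?_
    simp only
    rw [← h3]
    module
  rw [cayleySq, sub_mul, one_mul, smul_mul_assoc, h4, add_sub_cancel_right]

end Cayley

/-! ### Approximation of the identity by functions of `(1 + H²)⁻¹` -/

section FunctionalCalculus

variable {E : Type*} [NormedAddCommGroup E] [InnerProductSpace ℂ E] [CompleteSpace E]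
variable {H : E →ₗ.[ℂ] E} {m : E →L[ℂ] E}

theorem spectrum_invOneAddSq_subset (hH : IsSelfAdjoint H) (hm : boundedTransform H = ofBounded m)
    {t : ℝ} (ht : t ∈ spectrum ℝ (invOneAddSq H)) : 0 ≤ t ∧ t ≤ 1 := by
  refine ⟨spectrum_nonneg_of_nonneg (invOneAddSq_nonneg hH.isClosed hH.dense_domain) ht, ?_⟩
  have h := invOneAddSq_le_one hH hm
  rw [← map_one (algebraMap ℝ (E →L[ℂ] E)),
    le_algebraMap_iff_spectrum_le (isSelfAdjoint_invOneAddSq hH)] at h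
  exact h t ht

theorem cayleySq_eq_cfc (hH : IsSelfAdjoint H) (hm : boundedTransform H = ofBounded m) {μ : ℝ}
    (hμ : 1 ≤ μ) :
    cayleySq H μ = cfc (fun t : ℝ => (1 + (μ ^ 2 - 1) * t)⁻¹) (invOneAddSq H) := by
  have hsa := isSelfAdjoint_invOneAddSq hH
  have hpos : ∀ t ∈ spectrum ℝ (invOneAddSq H), 1 + (μ ^ 2 - 1) * t ≠ 0 := fun t ht => by
    have := (spectrum_invOneAddSq_subset hH hm ht).1
    have : 0 ≤ (μ ^ 2 - 1) * t := mul_nonneg (by nlinarith) this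
    positivity
  have h1 : cfc (fun t : ℝ => 1 + (μ ^ 2 - 1) * t) (invOneAddSq H) =
      1 + ((μ : ℂ) ^ 2 - 1) • invOneAddSq H := by
    rw [cfc_const_add _ _ _, cfc_const_mul_id _ _]
    have e : ((μ : ℂ) ^ 2 - 1) = ((μ ^ 2 - 1 : ℝ) : ℂ) := by push_cast; rfl
    rw [map_one, e]
    rfl
  have hcont : ContinuousOn (fun t : ℝ => (1 + (μ ^ 2 - 1) * t)⁻¹)
      (spectrum ℝ (invOneAddSq H)) := ContinuousOn.inv₀ (by fun_prop) hpos
  have h2 : cfc (fun t : ℝ => 1 + (μ ^ 2 - 1) * t) (invOneAddSq H) *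
      cfc (fun t : ℝ => (1 + (μ ^ 2 - 1) * t)⁻¹) (invOneAddSq H) = 1 := by
    rw [← cfc_mul _ _ _ (by fun_prop) hcont, ← cfc_one ℝ (invOneAddSq H)]
    exact cfc_congr fun t ht => mul_inv_cancel₀ (hpos t ht)
  rw [h1] at h2
  exact left_inv_eq_right_inv (cayleySq_mul hH hm (by positivity)) h2

theorem invSqrt_eq_cfc (hH : IsSelfAdjoint H) :
    invSqrtOneAddSq H = cfc Real.sqrt (invOneAddSq H) := by
  rw [invSqrtOneAddSq, CFC.sqrt_eq_real_sqrt _ (invOneAddSq_nonneg hH.isClosed hH.dense_domain),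
    cfcₙ_eq_cfc]

/-- The approximants of the identity `S ∑ₖ w (1 + s_k² G)⁻¹`. -/
noncomputable def approxOne (H : E →ₗ.[ℂ] E) (n : ℕ) : E →L[ℂ] E :=
  cfc (fun t : ℝ => √t * riemannSum n t) (invOneAddSq H)

theorem continuousOn_riemannSum_spectrum (hH : IsSelfAdjoint H) (n : ℕ) :
    ContinuousOn (riemannSum n) (spectrum ℝ (invOneAddSq H)) :=
  (continuousOn_riemannSum n).mono fun _ ht =>
    spectrum_nonneg_of_nonneg (invOneAddSq_nonneg hH.isClosed hH.dense_domain) ht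

theorem approxOne_eq (hH : IsSelfAdjoint H) (n : ℕ) :
    approxOne H n = invSqrtOneAddSq H * cfc (riemannSum n) (invOneAddSq H) := by
  rw [approxOne, invSqrt_eq_cfc hH, ← cfc_mul _ _ _ (by fun_prop)
    (continuousOn_riemannSum_spectrum hH n)]

theorem norm_approxOne_le (hH : IsSelfAdjoint H) (hm : boundedTransform H = ofBounded m) (n : ℕ) :
    ‖approxOne H n‖ ≤ 1 := by
  refine norm_cfc_le zero_le_one fun t ht => ?_
  have h := (spectrum_invOneAddSq_subset hH hm ht).1
  rw [Real.norm_of_nonneg (mul_nonneg (Real.sqrt_nonneg t) (riemannSum_nonneg n h))]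
  exact sqrt_mul_riemannSum_le_one n h

/-- The function `√t * riemannSum n t` vanishes at `t = 0`, so it cannot approach `1` uniformly if
`0` is in the spectrum; the extra factor `√t` restores a uniform rate. -/
theorem norm_invSqrt_sub_le (hH : IsSelfAdjoint H) (hm : boundedTransform H = ofBounded m) {n : ℕ}
    (hn : n ≠ 0) : ‖invSqrtOneAddSq H - approxOne H n * invSqrtOneAddSq H‖ ≤ 2 / n := by
  have hc := continuousOn_riemannSum_spectrum hH n
  rw [approxOne, invSqrt_eq_cfc hH, ← cfc_mul _ _ _ (by fun_prop) (by fun_prop),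
    ← cfc_sub _ _ _ (by fun_prop) (by fun_prop)]
  refine norm_cfc_le (by positivity) fun t ht => ?_
  obtain ⟨h0, h1⟩ := spectrum_invOneAddSq_subset hH hm ht
  have e : √t - √t * riemannSum n t * √t = √t - t * riemannSum n t := by
    rw [mul_right_comm, Real.mul_self_sqrt h0]
  have h2 : t * riemannSum n t ≤ √t := by
    have := mul_le_mul_of_nonneg_left (sqrt_mul_riemannSum_le_one n h0) (Real.sqrt_nonneg t)
    rwa [← mul_assoc, Real.mul_self_sqrt h0, mul_one] at this
  rw [e, Real.norm_of_nonneg (sub_nonneg.2 h2)]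
  exact sqrt_sub_mul_riemannSum_le hn h0 h1

/-- Contractions converging in norm on the dense range of `S` converge strongly everywhere. -/
theorem tendsto_approxOne (hH : IsSelfAdjoint H) (hm : boundedTransform H = ofBounded m) (x : E) :
    Filter.Tendsto (fun n => approxOne H n x) Filter.atTop (nhds x) := by
  rw [Metric.tendsto_atTop]
  intro ε hε
  obtain ⟨y, hy⟩ := (denseRange_invSqrt hH).exists_dist_lt x (ε := ε / 4) (by positivity)
  obtain ⟨n₀, hn₀⟩ := exists_nat_gt (4 * (2 * ‖y‖) / ε)
  refine ⟨n₀ + 1, fun n hn => ?_⟩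
  have hn0 : n ≠ 0 := by omega
  have hnpos : (0 : ℝ) < n := by positivity
  set S := invSqrtOneAddSq H
  have h1 : ‖S y - approxOne H n (S y)‖ ≤ ε / 4 := by
    have h2 := (S - approxOne H n * S).le_of_opNorm_le (norm_invSqrt_sub_le hH hm hn0) y
    refine (h2 : ‖S y - approxOne H n (S y)‖ ≤ _).trans ?_
    rw [div_mul_eq_mul_div, div_le_div_iff₀ hnpos (by norm_num)]
    rw [div_lt_iff₀ hε] at hn₀
    have h3 : (n₀ : ℝ) ≤ n := by exact_mod_cast (by omega : n₀ ≤ n)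
    nlinarith
  rw [dist_eq_norm] at hy ⊢
  have h4 := (approxOne H n).le_of_opNorm_le (norm_approxOne_le hH hm n) (x - S y)
  rw [map_sub, one_mul] at h4
  have e : approxOne H n x - x = (approxOne H n x - approxOne H n (S y)) -
      (S y - approxOne H n (S y)) - (x - S y) := by abel
  rw [e]
  have h5 := norm_sub_le ((approxOne H n x - approxOne H n (S y)) -
      (S y - approxOne H n (S y))) (x - S y)
  have h6 := norm_sub_le (approxOne H n x - approxOne H n (S y)) (S y - approxOne H n (S y))
  linarith

end FunctionalCalculus

/-! ### The uniform commutator bound -/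

section Estimate

variable {E : Type*} [NormedAddCommGroup E] [InnerProductSpace ℂ E] [CompleteSpace E]
variable {D H : E →ₗ.[ℂ] E} {m C : E →L[ℂ] E}

theorem inner_map_of_isSelfAdjoint {T : E →L[ℂ] E} (hT : IsSelfAdjoint T) (u v : E) :
    ⟪T u, v⟫_ℂ = ⟪u, T v⟫_ℂ := by
  conv_lhs => rw [← hT.star_eq, ContinuousLinearMap.star_eq_adjoint,
    ContinuousLinearMap.adjoint_inner_left]

theorem isSelfAdjoint_sqrt (S : E →L[ℂ] E) : IsSelfAdjoint (CFC.sqrt S) :=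
  IsSelfAdjoint.of_nonneg (CFC.sqrt_nonneg _)

theorem sqrt_invSqrt_mul_self (H : E →ₗ.[ℂ] E) :
    CFC.sqrt (invSqrtOneAddSq H) * CFC.sqrt (invSqrtOneAddSq H) = invSqrtOneAddSq H :=
  CFC.sqrt_mul_sqrt_self _ (CFC.sqrt_nonneg _)

/-- The form of `(H - i)⁻¹ C = (H - i)⁻¹ [D, H] (H + i)⁻¹` is bounded by `‖C‖` with respect to
that of `(1 + H²)^(-1/2)`. -/
theorem norm_inner_res_one_mul_le (hH : IsSelfAdjoint H) (hm : boundedTransform H = ofBounded m)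
    (hskew : star (res H 1 * C) = -(res H 1 * C)) (u v : E) :
    ‖⟪(res H 1 * C) u, v⟫_ℂ‖ ≤
      ‖C‖ * (‖CFC.sqrt (invSqrtOneAddSq H) u‖ * ‖CFC.sqrt (invSqrtOneAddSq H) v‖) := by
  obtain ⟨φ, hφ, hφ'⟩ := exists_isometry hH hm
  set T := CFC.sqrt (invSqrtOneAddSq H) with hT
  have hTs : IsSelfAdjoint T := isSelfAdjoint_sqrt _
  -- Since `T² φ = S φ = R 1`, this gives `T² c = i R 1 C`, the factor `i` turning skew into
  -- self-adjoint; `φ` being a contraction keeps `‖c‖ ≤ ‖C‖`.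
  set c : E →L[ℂ] E := Complex.I • (φ * C) with hc
  have hTc : T * T * c = Complex.I • (res H 1 * C) := by
    rw [sqrt_invSqrt_mul_self, hc, mul_smul_comm, ← mul_assoc, hφ']
  have hsa : IsSelfAdjoint (T * T * c) := by
    rw [hTc, IsSelfAdjoint, star_smul, hskew]
    simp
  have hcn : ‖c‖ ≤ ‖C‖ := by
    rw [hc, norm_smul, Complex.norm_I, one_mul]
    exact (norm_mul_le _ _).trans (mul_le_of_le_one_left (norm_nonneg _) hφ)
  have h1 : ‖⟪(res H 1 * C) u, v⟫_ℂ‖ = ‖⟪T (c u), T v⟫_ℂ‖ := by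
    rw [← inner_map_of_isSelfAdjoint hTs]
    have : T (T (c u)) = Complex.I • (res H 1 * C) u :=
      congrArg (fun A : E →L[ℂ] E => A u) hTc
    rw [this, inner_smul_left, norm_mul]
    simp
  rw [h1]
  calc ‖⟪T (c u), T v⟫_ℂ‖ ≤ ‖T (c u)‖ * ‖T v‖ := norm_inner_le_norm _ _
    _ ≤ ‖c‖ * ‖T u‖ * ‖T v‖ := by gcongr; exact norm_map_le_of_symmetric hTs hsa u
    _ ≤ ‖C‖ * ‖T u‖ * ‖T v‖ := by gcongr
    _ = _ := mul_assoc _ _ _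

theorem norm_sqrt_cayley_sq (hH : IsSelfAdjoint H) {μ : ℝ} (hμ : μ ≠ 0) (x : E) :
    ‖CFC.sqrt (invSqrtOneAddSq H) (cayley H μ x)‖ ^ 2 =
      RCLike.re ⟪(invSqrtOneAddSq H * cayleySq H μ) x, x⟫_ℂ := by
  have hc : Commute (invSqrtOneAddSq H) (star (cayley H μ)) := by
    rw [star_cayley hH hμ]
    exact (Commute.one_right _).sub_right
      ((res_commute_invSqrt hH (neg_ne_zero.2 hμ)).symm.smul_right _)
  rw [← star_cayley_mul_cayley hH hμ, ← mul_assoc, hc.eq, mul_assoc, mul_apply_eq_comp,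
    ContinuousLinearMap.star_eq_adjoint, ContinuousLinearMap.adjoint_inner_left,
    mul_apply_eq_comp]
  nth_rw 2 [← sqrt_invSqrt_mul_self H]
  rw [mul_apply_eq_comp, inner_map_of_isSelfAdjoint (isSelfAdjoint_sqrt _),
    inner_self_eq_norm_sq (𝕜 := ℂ)]

/-- The outer factors belong to `μ` and `-μ`, but `cayleySq` is even in `μ`, so `x` and `y` are
measured by the same quadratic form. -/
theorem norm_inner_cayley_le (hH : IsSelfAdjoint H) (hm : boundedTransform H = ofBounded m)
    (hskew : star (res H 1 * C) = -(res H 1 * C)) {μ : ℝ} (hμ : μ ≠ 0) (x y : E) :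
    ‖⟪(-(star (cayley H (-μ)) * (res H 1 * C) * cayley H μ)) x, y⟫_ℂ‖ ≤
      ‖C‖ * (√(RCLike.re ⟪(invSqrtOneAddSq H * cayleySq H μ) x, x⟫_ℂ) *
        √(RCLike.re ⟪(invSqrtOneAddSq H * cayleySq H μ) y, y⟫_ℂ)) := by
  rw [← norm_sqrt_cayley_sq hH hμ, ← cayleySq_neg hH hμ,
    ← norm_sqrt_cayley_sq hH (neg_ne_zero.2 hμ), Real.sqrt_sq (norm_nonneg _),
    Real.sqrt_sq (norm_nonneg _), neg_apply, inner_neg_left, norm_neg, mul_assoc,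
    mul_apply_eq_comp, ContinuousLinearMap.star_eq_adjoint,
    ContinuousLinearMap.adjoint_inner_left]
  exact norm_inner_res_one_mul_le hH hm hskew _ _

/-- The nodes `μ_k = (1 + s_k²)^(1/2)`, where `s_k = (k + 1) / n`. -/
noncomputable def node (n k : ℕ) : ℝ := √(1 + (((k + 1 : ℕ) : ℝ) / n) ^ 2)

theorem one_le_node (n k : ℕ) : 1 ≤ node n k := by
  rw [node, Real.one_le_sqrt]
  linarith [sq_nonneg (((k + 1 : ℕ) : ℝ) / n)]

theorem node_ne_zero (n k : ℕ) : node n k ≠ 0 := (one_pos.trans_le (one_le_node n k)).ne'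

theorem node_sq_sub_one (n k : ℕ) : node n k ^ 2 - 1 = (((k + 1 : ℕ) : ℝ) / n) ^ 2 := by
  rw [node, Real.sq_sqrt (by positivity), add_sub_cancel_left]

theorem sum_cayleySq (hH : IsSelfAdjoint H) (hm : boundedTransform H = ofBounded m) (n : ℕ) :
    ((2 / Real.pi * (1 / n) : ℝ) : ℂ) • ∑ k ∈ Finset.range (n ^ 2), cayleySq H (node n k) =
      cfc (riemannSum n) (invOneAddSq H) := by
  have hcont : ∀ k ∈ Finset.range (n ^ 2), ContinuousOn
      (fun t : ℝ => (1 + (((k + 1 : ℕ) : ℝ) / n) ^ 2 * t)⁻¹) (spectrum ℝ (invOneAddSq H)) := by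
    refine fun k _ => ContinuousOn.inv₀ (by fun_prop) fun t ht => ?_
    have := (spectrum_invOneAddSq_subset hH hm ht).1
    positivity
  have h1 : ∑ k ∈ Finset.range (n ^ 2), cayleySq H (node n k) =
      cfc (∑ k ∈ Finset.range (n ^ 2), fun t : ℝ => (1 + (((k + 1 : ℕ) : ℝ) / n) ^ 2 * t)⁻¹)
        (invOneAddSq H) := by
    rw [cfc_sum _ _ _ hcont]
    refine Finset.sum_congr rfl fun k _ => ?_
    rw [cayleySq_eq_cfc hH hm (one_le_node n k), node_sq_sub_one]
  have h2 : riemannSum n = fun t => (2 / Real.pi * (1 / n)) *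
      (∑ k ∈ Finset.range (n ^ 2), fun t : ℝ => (1 + (((k + 1 : ℕ) : ℝ) / n) ^ 2 * t)⁻¹) t := by
    funext t
    rw [riemannSum, Finset.sum_apply]
  rw [h1, h2, cfc_const_mul _ _ _ (ContinuousOn.congr (continuousOn_finsetSum _ hcont)
    fun t _ => Finset.sum_apply _ _ _)]
  rfl

/-- Both sides are `H (H² + μ²)⁻¹`, with `m S = H (1 + H²)⁻¹`. -/
theorem half_res_add_res_neg (hH : IsSelfAdjoint H) (hm : boundedTransform H = ofBounded m) {μ : ℝ}
    (hμ : μ ≠ 0) :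
    (1 / 2 : ℂ) • (res H μ + res H (-μ)) = m * invSqrtOneAddSq H * cayleySq H μ := by
  have h1 := res_mul_one_add hH hm hμ
  have h2 := res_mul_one_add hH hm (neg_ne_zero.2 hμ)
  rw [Complex.ofReal_neg, neg_sq] at h2
  have h3 := cayleySq_mul hH hm hμ
  set A := 1 + ((μ : ℂ) ^ 2 - 1) • invOneAddSq H
  have hR : ∀ ν : ℝ, ν ≠ 0 → Commute A (res H ν) := fun ν hν => by
    refine (Commute.one_left _).add_left (Commute.smul_left ?_ _)
    rw [← invSqrt_mul_self hH]
    exact (res_commute_invSqrt hH hν).symm.mul_left (res_commute_invSqrt hH hν).symm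
  have h4 : A * cayleySq H μ = 1 := by
    rw [← h3]
    exact (Commute.sub_right (Commute.one_right _)
      (((hR _ (neg_ne_zero.2 hμ)).mul_right (hR _ hμ)).smul_right _)).eq
  have h5 : (1 / 2 : ℂ) • (res H μ + res H (-μ)) * A = m * invSqrtOneAddSq H := by
    rw [smul_mul_assoc, add_mul, h1, h2]
    module
  rw [← h5, mul_assoc, h4, mul_one]

/-- The Riemann sums for `F(H) = π⁻¹ ∫₀^∞ λ^(-1/2) H (1 + λ + H²)⁻¹ dλ`. -/
noncomputable def approxTransform (H : E →ₗ.[ℂ] E) (n : ℕ) : E →L[ℂ] E :=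
  ((2 / Real.pi * (1 / n) : ℝ) : ℂ) • ∑ k ∈ Finset.range (n ^ 2),
    (1 / 2 : ℂ) • (res H (node n k) + res H (-node n k))

theorem approxTransform_eq (hH : IsSelfAdjoint H) (hm : boundedTransform H = ofBounded m) (n : ℕ) :
    approxTransform H n = m * approxOne H n := by
  rw [approxOne_eq hH, ← mul_assoc, ← sum_cayleySq hH hm, mul_smul_comm, Finset.mul_sum,
    approxTransform]
  congr 1
  exact Finset.sum_congr rfl fun k _ => half_res_add_res_neg hH hm (node_ne_zero n k)

/-- The weighted sum is exactly the quadratic form of the contraction `approxOne H n`. -/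
theorem weighted_sum_le (hH : IsSelfAdjoint H) (hm : boundedTransform H = ofBounded m) (n : ℕ)
    (x : E) :
    (2 / Real.pi * (1 / n)) * ∑ k ∈ Finset.range (n ^ 2),
      RCLike.re ⟪(invSqrtOneAddSq H * cayleySq H (node n k)) x, x⟫_ℂ ≤ ‖x‖ ^ 2 := by
  have h1 : ((2 / Real.pi * (1 / n)) * ∑ k ∈ Finset.range (n ^ 2),
      RCLike.re ⟪(invSqrtOneAddSq H * cayleySq H (node n k)) x, x⟫_ℂ : ℝ) =
      RCLike.re ⟪approxOne H n x, x⟫_ℂ := by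
    rw [approxOne_eq hH, ← sum_cayleySq hH hm, mul_smul_comm,
      Finset.mul_sum _ _ (invSqrtOneAddSq H), smul_apply,
      inner_smul_left, Complex.conj_ofReal, sum_apply, sum_inner]
    simp only [RCLike.re_to_complex, Complex.re_ofReal_mul, Complex.re_sum]
  rw [h1]
  calc RCLike.re ⟪approxOne H n x, x⟫_ℂ ≤ ‖approxOne H n x‖ * ‖x‖ := re_inner_le_norm _ _
    _ ≤ 1 * ‖x‖ * ‖x‖ := by
      gcongr
      exact (approxOne H n).le_of_opNorm_le (norm_approxOne_le hH hm n) x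
    _ = ‖x‖ ^ 2 := by ring

/-- The nodes are summed at the level of forms: Cauchy–Schwarz over `k` separates `x` from `y`, and
`weighted_sum_le` bounds each factor. -/
theorem exists_hasCommutator_approxTransform (hD : IsSelfAdjoint D) (hH : IsSelfAdjoint H)
    (hm : boundedTransform H = ofBounded m)
    (h1 : HasCommutator D (res H (-1)) (-(res H (-1) * C)))
    (hR : ∀ μ : ℝ, μ ≠ 0 → ∃ K, HasCommutator D (res H μ) K) (n : ℕ) :
    ∃ K, HasCommutator D (approxTransform H n) K ∧ ∀ x y, ‖⟪K x, y⟫_ℂ‖ ≤ ‖C‖ * ‖x‖ * ‖y‖ := by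
  have hskew := star_res_one_mul hD hH h1
  let κ : ℝ → E →L[ℂ] E := fun μ => -(star (cayley H (-μ)) * (res H 1 * C) * cayley H μ)
  have hκ : ∀ μ : ℝ, μ ≠ 0 → HasCommutator D (res H μ) (κ μ) := fun μ hμ => by
    obtain ⟨K, hK⟩ := hR μ hμ
    exact hasCommutator_res_of_neg_one hD hH hμ h1 hK
  let w : ℝ := 2 / Real.pi * (1 / n)
  have hw : 0 ≤ w := by positivity
  let j : E → ℕ → ℝ := fun x k =>
    RCLike.re ⟪(invSqrtOneAddSq H * cayleySq H (node n k)) x, x⟫_ℂ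
  have hj : ∀ x k, 0 ≤ j x k := fun x k => by
    simp only [j]
    rw [← norm_sqrt_cayley_sq hH (node_ne_zero n k)]
    positivity
  refine ⟨(w : ℂ) • ∑ k ∈ Finset.range (n ^ 2), (1 / 2 : ℂ) • (κ (node n k) + κ (-node n k)),
    HasCommutator.smul (HasCommutator.sum fun k _ => ((hκ _ (node_ne_zero n k)).add
      (hκ _ (neg_ne_zero.2 (node_ne_zero n k)))).smul _) _, fun x y => ?_⟩
  have hterm : ∀ k, ‖⟪((1 / 2 : ℂ) • (κ (node n k) + κ (-node n k))) x, y⟫_ℂ‖ ≤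
      ‖C‖ * (√(j x k) * √(j y k)) := fun k => by
    have h2 := norm_inner_cayley_le hH hm hskew (node_ne_zero n k) x y
    have h3 := norm_inner_cayley_le hH hm hskew (neg_ne_zero.2 (node_ne_zero n k)) x y
    rw [cayleySq_neg hH (node_ne_zero n k)] at h3
    rw [smul_apply, inner_smul_left, add_apply, inner_add_left, norm_mul]
    have h4 := norm_add_le ⟪κ (node n k) x, y⟫_ℂ ⟪κ (-node n k) x, y⟫_ℂ
    have h5 : ‖(starRingEnd ℂ) (1 / 2)‖ = 1 / 2 := by simp
    rw [h5]
    simp only [κ, j] at *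
    linarith
  rw [smul_apply, inner_smul_left, sum_apply, sum_inner, norm_mul, Complex.conj_ofReal,
    Complex.norm_real, Real.norm_of_nonneg hw]
  have hx := weighted_sum_le hH hm n x
  have hy := weighted_sum_le hH hm n y
  calc w * ‖∑ k ∈ Finset.range (n ^ 2), ⟪((1 / 2 : ℂ) • (κ (node n k) + κ (-node n k))) x, y⟫_ℂ‖
      ≤ w * ∑ k ∈ Finset.range (n ^ 2), ‖C‖ * (√(j x k) * √(j y k)) := by
        gcongr
        exact norm_sum_le_of_le _ fun k _ => hterm k
    _ = ‖C‖ * (w * ∑ k ∈ Finset.range (n ^ 2), √(j x k) * √(j y k)) := by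
        rw [← Finset.mul_sum]; ring
    _ ≤ ‖C‖ * (w * (√(∑ k ∈ Finset.range (n ^ 2), j x k) *
          √(∑ k ∈ Finset.range (n ^ 2), j y k))) := by
        gcongr
        exact Real.sum_sqrt_mul_sqrt_le _ (hj x) (hj y)
    _ = ‖C‖ * (√(w * ∑ k ∈ Finset.range (n ^ 2), j x k) *
          √(w * ∑ k ∈ Finset.range (n ^ 2), j y k)) := by
        rw [Real.sqrt_mul hw, Real.sqrt_mul hw, mul_mul_mul_comm (√w), Real.mul_self_sqrt hw]
    _ ≤ ‖C‖ * (√(‖x‖ ^ 2) * √(‖y‖ ^ 2)) := by gcongr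
    _ = ‖C‖ * ‖x‖ * ‖y‖ := by
        rw [Real.sqrt_sq (norm_nonneg _), Real.sqrt_sq (norm_nonneg _), mul_assoc]

theorem exists_hasCommutator_transform (hD : IsSelfAdjoint D) (hH : IsSelfAdjoint H)
    (hm : boundedTransform H = ofBounded m)
    (h1 : HasCommutator D (res H (-1)) (-(res H (-1) * C)))
    (hR : ∀ μ : ℝ, μ ≠ 0 → ∃ K, HasCommutator D (res H μ) K) :
    ∃ K, HasCommutator D m K ∧ ‖K‖ ≤ ‖C‖ := by
  choose G hG hG' using exists_hasCommutator_approxTransform hD hH hm h1 hR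
  refine HasCommutator.exists_of_tendsto hD (norm_nonneg C) hG hG' fun x => ?_
  simp_rw [approxTransform_eq hH hm]
  exact (m.continuous.tendsto x).comp (tendsto_approxOne hH hm x)

end Estimate

/-! ### Differentiability of bounded self-adjoint operators -/

section Bounded

theorem hasCore_domain {E : Type*} [NormedAddCommGroup E] [InnerProductSpace ℂ E]
    {D : E →ₗ.[ℂ] E} (hD : D.IsClosed) : D.HasCore D.domain where
  le_domain := le_rfl
  closure_eq := by
    have h : D.domRestrict D.domain = D := LinearPMap.ext (by simp) fun x _ _ => rfl
    rw [h]
    exact LinearPMap.eq_of_eq_graph (by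
      rw [← hD.isClosable.graph_closure_eq_closure_graph]; exact hD.submodule_topologicalClosure_eq)

variable {E : Type*} [NormedAddCommGroup E] [InnerProductSpace ℂ E] [CompleteSpace E]

theorem isSelfAdjoint_ofBounded {m : E →L[ℂ] E} (hm : IsSelfAdjoint m) :
    IsSelfAdjoint (ofBounded m) := by
  have h := ContinuousLinearMap.toPMap_adjoint_eq_adjoint_toPMap_of_dense m
    (p := (⊤ : Submodule ℂ E))
    (by simp)
  rw [← ContinuousLinearMap.star_eq_adjoint, hm.star_eq] at h
  exact h

theorem isAffiliated_ofBounded {N : VonNeumannAlgebra E} {m : E →L[ℂ] E} (hm : IsSelfAdjoint m)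
    (hN : m ∈ N) : IsAffiliated N (ofBounded m) where
  isClosed := (isSelfAdjoint_ofBounded hm).isClosed
  dense_domain := (isSelfAdjoint_ofBounded hm).dense_domain
  commute _ _ hUN x := ⟨trivial,
    congrArg (fun T : E →L[ℂ] E => T x) (VonNeumannAlgebra.mem_commutant_iff.1 hUN m hN)⟩

/-- All of `Dom D` serves as core: `m - iμ` has a bounded commutator, so its inverse preserves `Dom
D`, and `[D,m](m - iμ)⁻¹` is a product of bounded operators. -/
theorem isDifferentiable_ofBounded {N : VonNeumannAlgebra E} {D : E →ₗ.[ℂ] E} {m K : E →L[ℂ] E}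
    (hD : IsSelfAdjoint D) (hDN : IsAffiliated N D) (hm : IsSelfAdjoint m) (hmN : m ∈ N)
    (hK : HasCommutator D m K) : IsDifferentiable N D (ofBounded m) := by
  have hsa := isSelfAdjoint_ofBounded hm
  have hinv : ∀ μ : ℝ, μ ≠ 0 →
      (m - (Complex.I * μ) • 1) * res (ofBounded m) μ = 1 ∧
        res (ofBounded m) μ * (m - (Complex.I * μ) • 1) = 1 := by
    intro μ hμ
    constructor
    · refine ContinuousLinearMap.ext fun x => ?_
      obtain ⟨h1, h2⟩ := res_spec hsa hμ x
      have h3 : m (res (ofBounded m) μ x) = x + (Complex.I * μ) • res (ofBounded m) μ x := h2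
      simp [h3]
    · refine ContinuousLinearMap.ext fun x => ?_
      exact res_apply_sub hsa hμ ⟨x, trivial⟩
  have hres : ∀ μ : ℝ, μ ≠ 0 → HasCommutator D (res (ofBounded m) μ)
      (-(res (ofBounded m) μ * K * res (ofBounded m) μ)) := fun μ hμ => by
    have h := hK.sub (HasCommutator.one.smul (Complex.I * μ))
    rw [smul_zero, sub_zero] at h
    exact h.inv hD (hinv μ hμ).1 (hinv μ hμ).2
  refine ⟨hsa, isAffiliated_ofBounded hm hmN, D.domain, hasCore_domain hD.isClosed, ?_, ?_⟩
  · intro μ hμ x hx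
    obtain ⟨h1, h2⟩ := resolvent_eq hsa hμ x
    refine ⟨h1, trivial, ?_, trivial⟩
    rw [h2]
    exact (hres μ hμ ⟨x, hx⟩).1
  · intro μ hμ
    -- An inverse commutes with everything that `m - iμ` commutes with, hence lies in `N'' = N`.
    have hresN : res (ofBounded m) μ ∈ N := by
      rw [← VonNeumannAlgebra.commutant_commutant N, VonNeumannAlgebra.mem_commutant_iff]
      intro T hT
      have hTm := VonNeumannAlgebra.mem_commutant_iff.1 hT m hmN
      have hc : Commute T (m - (Complex.I * μ) • 1) :=
        Commute.sub_right hTm.symm ((Commute.one_right T).smul_right _)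
      obtain ⟨h1, h2⟩ := hinv μ hμ
      set Q := res (ofBounded m) μ
      calc T * Q = Q * (m - (Complex.I * μ) • 1) * T * Q := by rw [h2, one_mul]
        _ = Q * (T * (m - (Complex.I * μ) • 1)) * Q := by rw [hc.eq]; simp only [mul_assoc]
        _ = Q * T * ((m - (Complex.I * μ) • 1) * Q) := by simp only [mul_assoc]
        _ = Q * T := by rw [h1, mul_one]
    refine ⟨K * res (ofBounded m) μ, mul_mem (hK.mem hDN hmN) hresN, fun x hx => ?_⟩
    obtain ⟨h1, h2⟩ := resolvent_eq hsa hμ x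
    have h3 := (hres μ hμ ⟨x, hx⟩).1
    obtain ⟨h4, h5⟩ := hK.extendsFrom _ h3
    have h6 : resolvent (ofBounded m) (Complex.I * μ) ⟨x, h1⟩ ∈
        (commutator D (ofBounded m)).domain := by rw [h2]; exact h4
    refine ⟨mem_pcomp_domain.2 ⟨h1, h6⟩, ?_⟩
    rw [pcomp_apply h1 h6]
    have h7 : (⟨_, h6⟩ : (commutator D (ofBounded m)).domain) = ⟨_, h4⟩ := Subtype.ext h2
    rw [h7, h5]
    rfl

end Bounded

end Callias

/-! ### The main theorem -/

theorem mainTheorem9 {E : Type*} [NormedAddCommGroup E] [InnerProductSpace ℂ E] [CompleteSpace E]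
    (N : VonNeumannAlgebra E) (τ : (E →L[ℂ] E) → ENNReal) (D : E →ₗ.[ℂ] E)
    (𝒜 : NonUnitalStarSubalgebra ℂ (E →L[ℂ] E))
    (htriple : Callias.IsSemifiniteSpectralTriple N τ D 𝒜)
    (H : E →ₗ.[ℂ] E)
    (hmult : Callias.IsUnboundedMultiplier 𝒜.topologicalClosure N H)
    (hdiff : Callias.IsDifferentiable N D H) :
    Callias.IsDifferentiable N D (Callias.boundedTransform H) ∧
    ∃ K ∈ N,
      Callias.ExtendsFrom (Callias.commutator D (Callias.boundedTransform H)) D.domain K ∧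
      ∀ (V : Submodule ℂ E) (C : E →L[ℂ] E),
        Callias.IsDifferentiableOnCore N D H V →
        Callias.ExtendsFrom
          (Callias.pcomp (Callias.commutator D H) (Callias.resolvent H (-Complex.I))) V C →
        ‖K‖ ≤ ‖C‖ := by
  obtain ⟨m, hmM, hm⟩ := hmult.boundedTransform_mem
  have hD := htriple.isSelfAdjoint
  have hH := hdiff.isSelfAdjoint
  have key : ∀ (V : Submodule ℂ E) (C : E →L[ℂ] E), Callias.IsDifferentiableOnCore N D H V →
      Callias.ExtendsFrom
        (Callias.pcomp (Callias.commutator D H) (Callias.resolvent H (-Complex.I))) V C →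
      ∃ K, Callias.HasCommutator D m K ∧ ‖K‖ ≤ ‖C‖ := by
    intro V C hV hC
    have e : (-Complex.I) = Complex.I * ((-1 : ℝ) : ℂ) := by push_cast; ring
    rw [e] at hC
    refine Callias.exists_hasCommutator_transform hD hH hm
      (Callias.hasCommutator_res hD hH hV (by norm_num) hC) fun μ hμ => ?_
    obtain ⟨B, -, hB⟩ := hV.bounded μ hμ
    exact ⟨_, Callias.hasCommutator_res hD hH hV hμ hB⟩
  obtain ⟨V, hV⟩ := hdiff.exists_core
  obtain ⟨C, -, hC⟩ := hV.bounded (-1) (by norm_num)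
  have e : Complex.I * ((-1 : ℝ) : ℂ) = -Complex.I := by push_cast; ring
  rw [e] at hC
  obtain ⟨K, hK, -⟩ := key V C hV hC
  rw [hm]
  refine ⟨Callias.isDifferentiable_ofBounded hD htriple.isAffiliated
    (Callias.isSelfAdjoint_transform hH hm) hmM.1 hK, K, hK.mem htriple.isAffiliated hmM.1,
    hK.extendsFrom, fun V' C' hV' hC' => ?_⟩
  -- Another core may produce another `K'`, but the bounded extension of `[D,m]` from the dense `Dom
  -- D` is unique.
  obtain ⟨K', hK', hle⟩ := key V' C' hV' hC'
  rwa [hK.unique hD.dense_domain hK']
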